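/- Fix a function $L:\mathbb{C}\to\mathbb{C}$ with $e^{L(z)}=z$ for all $z\ne0$ (an arbitrary choice of logarithm, i.e. of branch), and read every power of $a$ or $b$ whose exponent is written as a fraction $s\ne0$ as $z^{s}=e^{sL(z)}$ for $z\ne0$ and $0^{s}=0$; powers of nonnegative reals are the usual real ones and $e^{w}=\exp(w)$. For $\mu,r\in\mathbb{C}$ let $$A_0(\mu,r)=1,\qquad A_t(\mu,r)=\frac{r}{t!}\prod_{j=1}^{t-1}(t\mu+r-j)\quad(t\ge1),\qquad \mathcal{B}(\mu;r;z)=\sum_{t\ge0}A_t(\mu,r)z^t ,$$ where convergence always means absolute convergence. Let $m,n\ge1$ be integers and consider the trinomial equation $x^{m+n}+ax^n+b=0$ with $a,b\in\mathbb{C}$, and put $K=\dfrac{m^mn^n}{(m+n)^{m+n}}$. Define $$u_\ell=e^{\frac{i\pi(2\ell+1)}{m+n}}\,b^{\frac1{m+n}}\,\mathcal{B}\Bigl(\tfrac{n}{m+n};\tfrac1{m+n};e^{\frac{i\pi(2\ell+1)n}{m+n}}\tfrac{a}{b^{m/(m+n)}}\Bigr)\quad(0\le\ell\le m+n-1,\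 b\ne0),$$ $$v_\ell=e^{\frac{i\pi(2\ell+1)}{n}}\,\tfrac{b^{1/n}}{a^{1/n}}\,\mathcal{B}\Bigl(\tfrac{m+n}{n};\tfrac1n;e^{\frac{i\pi(2\ell+1)(m+n)}{n}}\tfrac{b^{m/n}}{a^{(m+n)/n}}\Bigr)\quad(0\le\ell\le n-1,\ a\neq0),$$ $$w_\ell=e^{\frac{i\pi(2\ell+1)}{m}}\,a^{\frac1m}\,\mathcal{B}\Bigl(-\tfrac nm;\tfrac1m;e^{-\frac{i\pi(2\ell+1)n}{m}}\tfrac{b}{a^{(m+n)/m}}\Bigr)\quad(0\le\ell\le m-1,\ a\ne0).$$ 1. Let $b\ne0$. For each $\ell$ the series in $u_\ell$ converges if and only if $\dfrac{|a|}{|b|^{m/(m+n)}}\le\dfrac{m+n}{n^{n/(m+n)}m^{m/(m+n)}}$; for $a\ne0$ this is equivalent to $|b|^m/|a|^{m+n}\ge K$. In this case (which includes $a=0$) $u_0,\dots,u_{m+n-1}$ are all the $m+n$ roots of the trinomial, counted with multiplicity. 2. Let $a\ne0$. For each $\ell$ the series in $v_\ell$ converges if and only if $\dfrac{|b|^{m/n}}{|a|^{(m+n)/n}}\le\dfrac{n}{(m+n)^{(m+n)/n}m^{-m/n}}$,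 and the series in $w_\ell$ converges if and only if $\dfrac{|b|}{|a|^{(m+n)/m}}\le\dfrac{m}{n^{-n/m}(m+n)^{(m+n)/m}}$; each of these two conditions is equivalent to $|b|^m/|a|^{m+n}\le K$. In this case $v_0,\dots,v_{n-1},w_0,\dots,w_{m-1}$ together are all the $m+n$ roots of the trinomial, counted with multiplicity. 3. For fixed $a\ne0$, as $b\to0$ one has $v_\ell\to0$ for every $\ell$ and $w_\ell\to e^{i\pi(2\ell+1)/m}a^{1/m}$, and these $m$ limits are all the $m$-th roots of $-a$. 4. Consequently, for all $(a,b)\ne(0,0)$, either $b\ne0$, all the series in $u_0,\dots,u_{m+n-1}$ converge and these are all the roots, or $a\ne0$, all the series in $v_0,\dots,v_{n-1}$ and $w_0,\dots,w_{m-1}$ converge and these together are all the roots (with multiplicity). -/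

import Mathlib

open Polynomial Filter Topology

noncomputable section

namespace FussCatalan

/-- The Fuss–Catalan number `A_t(μ, r)`: it is `1` for `t = 0` and
`(r / t!) * ∏_{j=1}^{t-1} (t μ + r - j)` for `t ≥ 1`. -/
def coeff (μ r : ℂ) (t : ℕ) : ℂ :=
  if t = 0 then 1
  else r / (t.factorial : ℂ) * ∏ j ∈ Finset.Icc 1 (t - 1), ((t : ℂ) * μ + r - (j : ℂ))

/-- The Fuss–Catalan series `B(μ; r; z) = ∑_t A_t(μ, r) z ^ t`. -/
def series (μ r z : ℂ) : ℂ := ∑' t : ℕ, coeff μ r t * z ^ t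

/-- Absolute convergence of the Fuss–Catalan series `B(μ; r; z)`. -/
def SeriesConverges (μ r z : ℂ) : Prop := Summable fun t : ℕ => ‖coeff μ r t * z ^ t‖

/-- `L` is a choice of a logarithm of every nonzero complex number. The choice is arbitrary, so
that every position of the branch cut is covered. -/
def IsLogChoice (L : ℂ → ℂ) : Prop := ∀ z : ℂ, z ≠ 0 → Complex.exp (L z) = z

/-- The power `z ^ s = exp (s * L z)` for the chosen logarithm `L`; powers of `0` follow the
convention of `Complex.cpow`. -/
def powBy (L : ℂ → ℂ) (z s : ℂ) : ℂ :=
  if z = 0 then (if s = 0 then 1 else 0) else Complex.exp (s * L z)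

/-- The logarithm with its cut along the positive real axis, i.e. with `0 ≤ arg z < 2π`. -/
def logPosCut (z : ℂ) : ℂ :=
  if 0 ≤ z.arg then Complex.log z else Complex.log z + 2 * (Real.pi : ℂ) * Complex.I

theorem isLogChoice_logPosCut : IsLogChoice logPosCut := by
  intro z hz
  unfold logPosCut
  split_ifs
  · exact Complex.exp_log hz
  · rw [Complex.exp_add, Complex.exp_two_pi_mul_I, mul_one, Complex.exp_log hz]

/-- `exp (i π (2 ℓ + 1) s)`, written `ε_ℓ ^ s` below. -/
def phase (ℓ : ℕ) (s : ℂ) : ℂ :=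
  Complex.exp (Complex.I * (Real.pi : ℂ) * (2 * (ℓ : ℂ) + 1) * s)

/-- Argument of the first series: `ε_ℓ ^ (n/(m+n)) * a / b ^ (m/(m+n))`. -/
def arg1 (L : ℂ → ℂ) (m n : ℕ) (a b : ℂ) (ℓ : ℕ) : ℂ :=
  phase ℓ ((n : ℂ) / ((m : ℂ) + n)) * (a / powBy L b ((m : ℂ) / ((m : ℂ) + n)))

/-- Argument of the second series: `ε_ℓ ^ ((m+n)/n) * b ^ (m/n) / a ^ ((m+n)/n)`. -/
def arg2 (L : ℂ → ℂ) (m n : ℕ) (a b : ℂ) (ℓ : ℕ) : ℂ :=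
  phase ℓ (((m : ℂ) + n) / n) *
    (powBy L b ((m : ℂ) / n) / powBy L a (((m : ℂ) + n) / n))

/-- Argument of the third series: `ε_ℓ ^ (-n/m) * b / a ^ ((m+n)/m)`. -/
def arg3 (L : ℂ → ℂ) (m n : ℕ) (a b : ℂ) (ℓ : ℕ) : ℂ :=
  phase ℓ (-(n : ℂ) / m) * (b / powBy L a (((m : ℂ) + n) / m))

/-- First series solution, `μ = n/(m+n)`, indexed by `0 ≤ ℓ ≤ m+n-1`. -/
def root1 (L : ℂ → ℂ) (m n : ℕ) (a b : ℂ) (ℓ : ℕ) : ℂ :=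
  phase ℓ (1 / ((m : ℂ) + n)) * powBy L b (1 / ((m : ℂ) + n)) *
    series ((n : ℂ) / ((m : ℂ) + n)) (1 / ((m : ℂ) + n)) (arg1 L m n a b ℓ)

/-- Second series solution, `μ = (m+n)/n`, indexed by `0 ≤ ℓ ≤ n-1`. -/
def root2 (L : ℂ → ℂ) (m n : ℕ) (a b : ℂ) (ℓ : ℕ) : ℂ :=
  phase ℓ (1 / (n : ℂ)) * (powBy L b (1 / (n : ℂ)) / powBy L a (1 / (n : ℂ))) *
    series (((m : ℂ) + n) / n) (1 / (n : ℂ)) (arg2 L m n a b ℓ)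

/-- Third series solution, `μ = -n/m`, indexed by `0 ≤ ℓ ≤ m-1`. -/
def root3 (L : ℂ → ℂ) (m n : ℕ) (a b : ℂ) (ℓ : ℕ) : ℂ :=
  phase ℓ (1 / (m : ℂ)) * powBy L a (1 / (m : ℂ)) *
    series (-(n : ℂ) / m) (1 / (m : ℂ)) (arg3 L m n a b ℓ)

/-- Absolute convergence of the first series. -/
def Converges1 (L : ℂ → ℂ) (m n : ℕ) (a b : ℂ) (ℓ : ℕ) : Prop :=
  SeriesConverges ((n : ℂ) / ((m : ℂ) + n)) (1 / ((m : ℂ) + n)) (arg1 L m n a b ℓ)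

/-- Absolute convergence of the second series. -/
def Converges2 (L : ℂ → ℂ) (m n : ℕ) (a b : ℂ) (ℓ : ℕ) : Prop :=
  SeriesConverges (((m : ℂ) + n) / n) (1 / (n : ℂ)) (arg2 L m n a b ℓ)

/-- Absolute convergence of the third series. -/
def Converges3 (L : ℂ → ℂ) (m n : ℕ) (a b : ℂ) (ℓ : ℕ) : Prop :=
  SeriesConverges (-(n : ℂ) / m) (1 / (m : ℂ)) (arg3 L m n a b ℓ)

/-- The trinomial `X ^ (m+n) + a X ^ n + b`. -/
def trinomial (m n : ℕ) (a b : ℂ) : ℂ[X] := X ^ (m + n) + C a * X ^ n + C b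

/-- The critical value `m ^ m * n ^ n / (m+n) ^ (m+n)`. -/
def bound (m n : ℕ) : ℝ := (m : ℝ) ^ m * (n : ℝ) ^ n / ((m : ℝ) + n) ^ (m + n)

/-- The finite family `f 0, …, f (k-1)`, as a multiset. -/
def family (k : ℕ) (f : ℕ → ℂ) : Multiset ℂ := (Multiset.range k).map f

end FussCatalan

end

namespace FussCatalan

/-! ### Algebraic identities of the coefficients -/

/-! Three independent facts carry the theorem.

Algebra. The Rothe–Hagen identity `sum_coeff_mul_coeff` says that `B(μ;r;z) B(μ;s;z) = B(μ;r+s;z)`,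
and `coeff_add_one` at `r = 0` says that `B(μ;1;z) = 1 + z B(μ;μ;z)`. Hence `y = B(p/q;1/q;z)`
satisfies `y^q = 1 + z y^p`, also for negative `p` after clearing denominators (`series_pow_eq`,
`series_neg_pow_eq`). A rescaling of `y` turns this equation into the trinomial, so every convergent
series gives a root.

Convergence. Here `μ` is rational, and if `N μ` is an integer then `A_{t+N} / A_t` is a rational
function of `t`, of the form `± c (1 - 3N/(2t) + o(1/t))`. The terms thus decay on the critical
circle like `t^(-3/2)`, so absolute convergence holds exactly on a closed disc
(`summable_iff_of_ratio`). The case `μ < 0` reduces to `μ > 1` by `coeff_one_sub`.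

Completeness. The series are analytic in the open disc and continuous on the closed one. Near the
centre they are pairwise distinct roots, as many as the degree, so the trinomial equals the product
of the linear factors there. The identity theorem and continuity carry this equality to the closed
disc, which also settles multiplicities (`eq_prod_of_distinct_near_zero`). For the first series the
variable is `a`, with `b` fixed. For the other two it is `β` with `β^n = b`: this removes the branch
of `b^(1/n)`, which need not be continuous. The two domains meet along `|b|^m / |a|^(m+n) = K` and
together cover all coefficients. -/

@[simp] theorem coeff_zero (μ r : ℂ) : coeff μ r 0 = 1 := by simp [coeff]

theorem coeff_succ (μ r : ℂ) (t : ℕ) :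
    coeff μ r (t + 1) = r / ((t + 1).factorial : ℂ) *
      ∏ i ∈ Finset.range t, (((t : ℂ) + 1) * μ + r - 1 - (i : ℂ)) := by
  simp only [coeff, Nat.add_one_ne_zero, if_false, Nat.add_sub_cancel]
  rw [show Finset.Icc 1 t = Finset.Ico 1 (t + 1) from rfl, Finset.prod_Ico_eq_prod_range,
    Nat.add_sub_cancel]
  congr 1
  refine Finset.prod_congr rfl fun i _ => ?_
  push_cast; ring

theorem coeff_zero_right (μ : ℂ) (t : ℕ) : coeff μ 0 t = if t = 0 then 1 else 0 := by
  cases t <;> simp [coeff]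

/-- The coefficient as a polynomial in its second parameter. -/
noncomputable def coeffPoly (μ : ℂ) (t : ℕ) : ℂ[X] :=
  if t = 0 then 1
  else C (1 / (t.factorial : ℂ)) * X * ∏ j ∈ Finset.Icc 1 (t - 1), (X + C ((t : ℂ) * μ - (j : ℂ)))

theorem eval_coeffPoly (μ r : ℂ) (t : ℕ) : (coeffPoly μ t).eval r = coeff μ r t := by
  unfold coeffPoly coeff
  split_ifs
  · simp
  · simp only [eval_mul, eval_C, eval_X, eval_prod, eval_add]
    congr 1
    · ring
    · exact Finset.prod_congr rfl fun j _ => by ring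

/-- The three products agree up to one factor at an end. For generating functions this reads
`B(μ;r+1) = B(μ;r) + z B(μ;r+μ)`. -/
theorem coeff_add_one (μ r : ℂ) (t : ℕ) :
    coeff μ (r + 1) (t + 1) = coeff μ r (t + 1) + coeff μ (r + μ) t := by
  cases t with
  | zero => simp [coeff]
  | succ t =>
    rw [coeff_succ, coeff_succ, coeff_succ, Finset.prod_range_succ', Finset.prod_range_succ]
    have h1 : ∏ i ∈ Finset.range t, (((t + 1 : ℕ) + 1 : ℂ) * μ + (r + 1) - 1 - ((i + 1 : ℕ) : ℂ)) =
        ∏ i ∈ Finset.range t, (((t : ℂ) + 1) * μ + (r + μ) - 1 - (i : ℂ)) :=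
      Finset.prod_congr rfl fun i _ => by push_cast; ring
    have h2 : ∏ i ∈ Finset.range t, (((t + 1 : ℕ) + 1 : ℂ) * μ + r - 1 - (i : ℂ)) =
        ∏ i ∈ Finset.range t, (((t : ℂ) + 1) * μ + (r + μ) - 1 - (i : ℂ)) :=
      Finset.prod_congr rfl fun i _ => by push_cast; ring
    rw [h1, h2, Nat.factorial_succ (t + 1)]
    have h3 : ((t + 1).factorial : ℂ) ≠ 0 := by exact_mod_cast (t + 1).factorial_ne_zero
    have h4 : ((t : ℂ) + 1 + 1) ≠ 0 := by exact_mod_cast (t + 1).succ_ne_zero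
    push_cast
    field_simp
    ring

/-- The Rothe–Hagen convolution identity. -/
theorem sum_coeff_mul_coeff (μ r s : ℂ) (t : ℕ) :
    ∑ p ∈ Finset.HasAntidiagonal.antidiagonal t, coeff μ r p.1 * coeff μ s p.2 = coeff μ (r + s) t := by
  induction t generalizing r s with
  | zero => simp
  | succ t ih =>
    -- Natural first parameters come by a second induction, through the shift `r ↦ r + 1`. The outer
    -- hypothesis must hold for all parameters, since it is used at `k + μ`.
    have key : ∀ k : ℕ, ∑ p ∈ Finset.HasAntidiagonal.antidiagonal (t + 1),
          coeff μ (k : ℂ) p.1 * coeff μ s p.2 =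
        coeff μ (k + s) (t + 1) := by
      intro k
      induction k with
      | zero => simp [Finset.Nat.antidiagonal_succ, coeff_zero_right]
      | succ k ihk =>
        rw [Finset.Nat.antidiagonal_succ, Finset.sum_cons, Finset.sum_map] at ihk ⊢
        simp only [Function.Embedding.prodMap, Function.Embedding.coeFn_mk, Prod.map,
          Function.Embedding.refl_apply, Nat.succ_eq_add_one, coeff_zero, one_mul] at ihk ⊢
        push_cast
        simp only [coeff_add_one, add_mul, Finset.sum_add_distrib]
        rw [ih, ← add_assoc, ihk, show (k : ℂ) + 1 + s = (k + s) + 1 by ring, coeff_add_one,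
          show (k : ℂ) + μ + s = k + s + μ by ring]
    -- Both sides are polynomials in the first parameter, so agreement at all natural numbers is
    -- enough.
    have hp : (∑ p ∈ Finset.HasAntidiagonal.antidiagonal (t + 1),
        coeffPoly μ p.1 * C (coeff μ s p.2)) =
        (coeffPoly μ (t + 1)).comp (X + C s) := by
      refine Polynomial.eq_of_infinite_eval_eq _ _ ?_
      refine (Set.infinite_range_of_injective (Nat.cast_injective (R := ℂ))).mono ?_
      rintro _ ⟨k, rfl⟩
      simpa [eval_finsetSum, eval_coeffPoly] using key k
    have := congrArg (Polynomial.eval r) hp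
    simpa [eval_finsetSum, eval_coeffPoly] using this

/-- Reversing the order of the product changes the sign of each factor. This carries `μ = -n/m` to
`1 - μ = (m+n)/m`. -/
theorem coeff_one_sub (μ r : ℂ) (t : ℕ) :
    coeff (1 - μ) (-r) t = (-1) ^ t * coeff μ r t := by
  cases t with
  | zero => simp
  | succ t =>
    rw [coeff_succ, coeff_succ, ← Finset.prod_range_reflect]
    have : ∏ j ∈ Finset.range t, (((t : ℂ) + 1) * (1 - μ) + -r - 1 - ((t - 1 - j : ℕ) : ℂ)) =
        (-1) ^ t * ∏ j ∈ Finset.range t, (((t : ℂ) + 1) * μ + r - 1 - (j : ℂ)) := by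
      conv_rhs => rw [← Finset.card_range t, ← Finset.prod_const, Finset.card_range,
        ← Finset.prod_mul_distrib]
      refine Finset.prod_congr rfl fun j hj => ?_
      have : j + 1 ≤ t := Finset.mem_range.1 hj
      rw [show t - 1 - j = t - (j + 1) by omega, Nat.cast_sub this]
      push_cast; ring
    rw [this]; ring

/-! ### Identities of the series -/

theorem seriesConverges_zero_arg (μ r : ℂ) : SeriesConverges μ r 0 := by
  refine summable_of_ne_finset_zero (s := {0}) fun t ht => ?_
  have : t ≠ 0 := by simpa using ht
  simp [this]

theorem series_zero_arg (μ r : ℂ) : series μ r 0 = 1 := by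
  rw [series, tsum_eq_single 0]
  · simp
  · intro t ht; simp [ht]

theorem seriesConverges_zero_param (μ z : ℂ) : SeriesConverges μ 0 z := by
  refine summable_of_ne_finset_zero (s := {0}) fun t ht => ?_
  have : t ≠ 0 := by simpa using ht
  simp [this, coeff_zero_right]

theorem series_zero_param (μ z : ℂ) : series μ 0 z = 1 := by
  rw [series, tsum_eq_single 0]
  · simp
  · intro t ht; simp [ht, coeff_zero_right]

theorem sum_antidiagonal_terms (μ r s z : ℂ) (t : ℕ) :
    ∑ p ∈ Finset.HasAntidiagonal.antidiagonal t, coeff μ r p.1 * z ^ p.1 * (coeff μ s p.2 * z ^ p.2) =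
      coeff μ (r + s) t * z ^ t := by
  rw [← sum_coeff_mul_coeff, Finset.sum_mul]
  refine Finset.sum_congr rfl fun p hp => ?_
  rw [← Finset.HasAntidiagonal.mem_antidiagonal.1 hp, pow_add]; ring

theorem SeriesConverges.add {μ r s z : ℂ} (hr : SeriesConverges μ r z)
    (hs : SeriesConverges μ s z) : SeriesConverges μ (r + s) z := by
  have := summable_norm_sum_mul_antidiagonal_of_summable_norm hr hs
  simp only [sum_antidiagonal_terms] at this
  exact this

theorem series_mul_series {μ r s z : ℂ} (hr : SeriesConverges μ r z)
    (hs : SeriesConverges μ s z) : series μ r z * series μ s z = series μ (r + s) z := by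
  have := tsum_mul_tsum_eq_tsum_sum_antidiagonal_of_summable_norm hr hs
  simp only [sum_antidiagonal_terms] at this
  exact this

theorem SeriesConverges.nat_mul {μ r z : ℂ} (hr : SeriesConverges μ r z) (k : ℕ) :
    SeriesConverges μ (k * r) z := by
  induction k with
  | zero => simpa using seriesConverges_zero_param μ z
  | succ k ih => simpa [add_mul] using ih.add hr

theorem series_pow {μ r z : ℂ} (hr : SeriesConverges μ r z) (k : ℕ) :
    series μ r z ^ k = series μ (k * r) z := by
  induction k with
  | zero => simp [series_zero_param]
  | succ k ih => rw [pow_succ, ih, series_mul_series (hr.nat_mul k) hr]; simp [add_mul]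

theorem coeff_one (μ : ℂ) (t : ℕ) : coeff μ 1 (t + 1) = coeff μ μ t := by
  simpa [coeff_zero_right] using coeff_add_one μ 0 t

theorem seriesConverges_self {μ z : ℂ} (h : SeriesConverges μ 1 z) : SeriesConverges μ μ z := by
  rcases eq_or_ne z 0 with rfl | hz
  · exact seriesConverges_zero_arg _ _
  · have h1 := (summable_nat_add_iff 1).2 h
    refine (h1.mul_left ‖z‖⁻¹).congr fun t => ?_
    have : ‖z‖ ≠ 0 := norm_ne_zero_iff.2 hz
    rw [coeff_one, pow_succ, norm_mul, norm_mul, norm_mul]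
    field_simp

theorem series_one {μ z : ℂ} (h : SeriesConverges μ 1 z) :
    series μ 1 z = 1 + z * series μ μ z := by
  rw [series, h.of_norm.tsum_eq_zero_add]
  simp only [coeff_zero, pow_zero, mul_one, coeff_one, series]
  rw [← tsum_mul_left]
  congr 1
  exact tsum_congr fun t => by ring

/-- The defining equation of `B(p/q; 1/q; z)`. -/
theorem series_pow_eq {p q : ℕ} (hq : q ≠ 0) {z : ℂ}
    (h : SeriesConverges ((p : ℂ) / q) (1 / (q : ℂ)) z) :
    series ((p : ℂ) / q) (1 / (q : ℂ)) z ^ q = 1 + z * series ((p : ℂ) / q) (1 / (q : ℂ)) z ^ p := by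
  have hq' : (q : ℂ) ≠ 0 := Nat.cast_ne_zero.2 hq
  rw [series_pow h, series_pow h]
  have h1 := h.nat_mul q
  rw [mul_one_div_cancel hq'] at h1 ⊢
  rw [series_one h1, mul_one_div]

/-- The defining equation of `B(-p/q; 1/q; z)`. -/
theorem series_neg_pow_eq {p q : ℕ} (hq : q ≠ 0) {z : ℂ}
    (h : SeriesConverges (-(p : ℂ) / q) (1 / (q : ℂ)) z) :
    series (-(p : ℂ) / q) (1 / (q : ℂ)) z ^ (q + p) =
      series (-(p : ℂ) / q) (1 / (q : ℂ)) z ^ p + z := by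
  have hq' : (q : ℂ) ≠ 0 := Nat.cast_ne_zero.2 hq
  have h1 := h.nat_mul q
  have h2 := h.nat_mul p
  rw [pow_add, series_pow h, series_pow h]
  rw [mul_one_div_cancel hq'] at h1 ⊢
  -- The factor `y^p = B(μ;p/q)` is the inverse of `B(μ;μ)` because `μ = -p/q`.
  rw [series_one h1, add_mul, one_mul, mul_assoc, series_mul_series (seriesConverges_self h1) h2,
    show -(p : ℂ) / q + p * (1 / q) = 0 by ring, series_zero_param, mul_one]

/-! ### Sequences of the form `1 + α / t + o(1 / t)` -/

/-- `ρ t = 1 + α / t + o(1 / t)`. -/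
def HasRate (ρ : ℕ → ℝ) (α : ℝ) : Prop :=
  Tendsto (fun t : ℕ => (t : ℝ) * (ρ t - 1)) atTop (𝓝 α)

theorem HasRate.tendsto_one {ρ : ℕ → ℝ} {α : ℝ} (h : HasRate ρ α) : Tendsto ρ atTop (𝓝 1) := by
  have h1 := (h.mul (tendsto_inv_atTop_nhds_zero_nat (𝕜 := ℝ))).add_const 1
  rw [mul_zero, zero_add] at h1
  refine h1.congr' ?_
  filter_upwards [eventually_ge_atTop 1] with t ht
  have : (t : ℝ) ≠ 0 := by positivity
  field_simp
  ring

theorem HasRate.mul {ρ σ : ℕ → ℝ} {α β : ℝ} (hρ : HasRate ρ α) (hσ : HasRate σ β) :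
    HasRate (fun t => ρ t * σ t) (α + β) := by
  have h1 := (Tendsto.mul hρ hσ.tendsto_one).add hσ
  rw [mul_one] at h1
  exact h1.congr fun t => by ring

theorem HasRate.inv {ρ : ℕ → ℝ} {α : ℝ} (hρ : HasRate ρ α) : HasRate (fun t => (ρ t)⁻¹) (-α) := by
  have h1 := (Tendsto.div hρ hρ.tendsto_one one_ne_zero).neg
  rw [div_one] at h1
  refine h1.congr' ?_
  filter_upwards [hρ.tendsto_one.eventually_ne one_ne_zero] with t ht
  simp only [Pi.div_apply]
  field_simp
  ring

theorem HasRate.congr' {ρ σ : ℕ → ℝ} {α : ℝ} (hρ : HasRate ρ α) (h : ρ =ᶠ[atTop] σ) :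
    HasRate σ α :=
  Tendsto.congr' (h.mono fun t ht => by simp only [ht]) hρ

/-- The rising factorial `x (x + 1) ⋯ (x + k - 1)`. -/
def rising {R : Type*} [CommSemiring R] (x : R) (k : ℕ) : R := ∏ i ∈ Finset.range k, (x + i)

/-- The factor `(κt + c + i)/(κt)` contributes `(c + i)/κ`, and rates add under products. -/
theorem hasRate_rising {κ : ℝ} (hκ : 0 < κ) (c : ℝ) (k : ℕ) :
    HasRate (fun t : ℕ => rising (κ * t + c) k / (κ * t) ^ k)
      ((k * c + k * (k - 1) / 2) / κ) := by
  induction k with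
  | zero => simp [HasRate, rising]
  | succ k ih =>
    have h1 : HasRate (fun t : ℕ => (κ * t + c + k) / (κ * t)) ((c + k) / κ) := by
      refine tendsto_const_nhds.congr' ?_
      filter_upwards [eventually_ge_atTop 1] with t ht
      have : (t : ℝ) ≠ 0 := by positivity
      field_simp
      ring
    have h2 := ih.mul h1
    convert h2.congr' (Eventually.of_forall fun t => ?_) using 1
    · push_cast; field_simp; ring
    · simp only [rising, Finset.prod_range_succ, pow_succ]
      rw [mul_div_mul_comm]

theorem rising_pos {x : ℝ} (hx : 0 < x) (k : ℕ) : 0 < rising x k :=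
  Finset.prod_pos fun i _ => by positivity

theorem norm_rising {x : ℝ} (hx : 0 < x) (k : ℕ) : ‖rising (x : ℂ) k‖ = rising x k := by
  unfold rising
  rw [norm_prod]
  refine Finset.prod_congr rfl fun i _ => ?_
  rw [show (x : ℂ) + i = ((x + i : ℝ) : ℂ) by push_cast; rfl, Complex.norm_real,
    Real.norm_of_nonneg (by positivity)]

/-! ### A Raabe type criterion with step `N` -/

theorem summable_of_raabe {f : ℕ → ℝ} (hf : ∀ t, 0 ≤ f t) (N : ℕ) {δ : ℝ} (hδ : 0 < δ)
    (h : ∀ᶠ t : ℕ in atTop, δ * f t ≤ t * f t - (t + N) * f (t + N)) : Summable f := by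
  obtain ⟨T, hT⟩ := eventually_atTop.1 h
  -- A window of length `N` makes the `N`-step difference telescope with step one: `g t - g (t+1)`
  -- is the right side of the hypothesis.
  set g : ℕ → ℝ := fun t => ∑ i ∈ Finset.range N, ((t + i : ℕ) : ℝ) * f (t + i) with hg
  have hg0 : ∀ t, 0 ≤ g t := fun t => Finset.sum_nonneg fun i _ => mul_nonneg (by positivity) (hf _)
  have hstep : ∀ t, g t - g (t + 1) = t * f t - (t + N) * f (t + N) := by
    intro t
    have h1 := Finset.sum_range_succ' (fun i => ((t + i : ℕ) : ℝ) * f (t + i)) N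
    rw [Finset.sum_range_succ] at h1
    have h2 : g (t + 1) = ∑ i ∈ Finset.range N, ((t + (i + 1) : ℕ) : ℝ) * f (t + (i + 1)) :=
      Finset.sum_congr rfl fun i _ => by rw [add_assoc, add_comm 1 i]
    rw [← h2] at h1
    simp only [add_zero] at h1
    push_cast at h1
    simp only [hg] at h1 ⊢
    push_cast at h1 ⊢
    linarith
  rw [← summable_nat_add_iff T]
  refine summable_of_sum_range_le (c := g T / δ) (fun t => hf _) fun n => ?_
  have : ∀ n, δ * ∑ i ∈ Finset.range n, f (i + T) ≤ g T - g (T + n) := by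
    intro n
    induction n with
    | zero => simp
    | succ n ih =>
      have h1 := hT (T + n) (by omega)
      rw [← hstep] at h1
      rw [Finset.sum_range_succ, mul_add, add_comm n T, ← add_assoc]
      linarith
  rw [le_div_iff₀ hδ, mul_comm]
  linarith [this n, hg0 (T + n)]

/-- The rate `-3N/2` lies strictly below Raabe's threshold `-N`, so the critical case `c x^N = 1`
converges. One residue class modulo `N` with nonzero coefficients suffices for divergence beyond it.
-/
theorem summable_iff_of_ratio {A : ℕ → ℝ} (hA : ∀ t, 0 ≤ A t) {N : ℕ} (hN : 1 ≤ N) {c : ℝ}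
    (hc : 0 < c) {ρ : ℕ → ℝ} (hρ : HasRate ρ (-(3 * N / 2))) {t₀ : ℕ} (ht₀ : 0 < A t₀)
    (hpos : ∀ t ≥ t₀, 0 < ρ t) (hrec : ∀ t ≥ t₀, A (t + N) = A t * (c * ρ t)) {x : ℝ}
    (hx : 0 ≤ x) : Summable (fun t => A t * x ^ t) ↔ c * x ^ N ≤ 1 := by
  have hN' : (0 : ℝ) < N := by exact_mod_cast hN
  have hf : ∀ t, 0 ≤ A t * x ^ t := fun t => mul_nonneg (hA t) (pow_nonneg hx t)
  have hrec' : ∀ t ≥ t₀, A (t + N) * x ^ (t + N) = A t * x ^ t * (c * x ^ N * ρ t) := by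
    intro t ht
    rw [hrec t ht, pow_add]; ring
  constructor
  · intro hs
    by_contra! hlt
    have hx' : 0 < x := by
      rcases hx.eq_or_lt with rfl | h
      · rw [zero_pow (by omega)] at hlt; norm_num at hlt
      · exact h
    have hAk : ∀ k : ℕ, 0 < A (t₀ + N * k) := by
      intro k
      induction k with
      | zero => simpa using ht₀
      | succ k ih =>
        rw [mul_add, mul_one, ← add_assoc, hrec _ (by omega)]
        exact mul_pos ih (mul_pos hc (hpos _ (by omega)))
    have hev : ∀ᶠ t in atTop, 1 < c * x ^ N * ρ t := by
      have := hρ.tendsto_one.const_mul (c * x ^ N)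
      rw [mul_one] at this
      exact this.eventually (lt_mem_nhds hlt)
    obtain ⟨T, hT⟩ := eventually_atTop.1 hev
    -- This index is congruent to `t₀` modulo `N`, so its coefficient is positive, and it is at
    -- least `T`, so the terms no longer decrease along its class.
    set t₁ := t₀ + N * T with ht₁
    have hT1 : T ≤ t₁ := le_add_left (Nat.le_mul_of_pos_left T hN)
    have hge : ∀ k : ℕ, A t₁ * x ^ t₁ ≤ A (t₁ + N * k) * x ^ (t₁ + N * k) := by
      intro k
      induction k with
      | zero => simp
      | succ k ih =>
        rw [mul_add, mul_one, ← add_assoc, hrec' _ (by omega)]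
        refine ih.trans (le_mul_of_one_le_right (hf _) (hT _ (by omega)).le)
    have hlim : Tendsto (fun k : ℕ => A (t₁ + N * k) * x ^ (t₁ + N * k)) atTop (𝓝 0) := by
      refine hs.tendsto_atTop_zero.comp (tendsto_atTop_mono (fun k => ?_) tendsto_id)
      exact le_add_left (Nat.le_mul_of_pos_left k hN)
    have := ge_of_tendsto' hlim hge
    exact absurd this (not_le.2 (mul_pos (hAk T) (pow_pos hx' _)))
  · intro hle
    -- The limit of `t - (t + N) ρ t` is `3N/2 - N = N/2`; any `δ` strictly between `0` and `N/2`
    -- would do.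
    refine summable_of_raabe hf N (δ := N / 4) (by positivity) ?_
    have hlim : Tendsto (fun t : ℕ => (t : ℝ) - (t + N) * ρ t) atTop (𝓝 (N / 2)) := by
      have := (Tendsto.neg hρ).sub (hρ.tendsto_one.const_mul (N : ℝ))
      rw [show -(-(3 * (N : ℝ) / 2)) - N * 1 = N / 2 by ring] at this
      exact this.congr fun t => by ring
    filter_upwards [hlim.eventually (lt_mem_nhds (show (N : ℝ) / 4 < N / 2 by linarith)),
      eventually_ge_atTop t₀] with t ht htt
    rw [hrec' t htt]
    have h1 : A t * x ^ t * (c * x ^ N * ρ t) ≤ A t * x ^ t * ρ t :=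
      mul_le_mul_of_nonneg_left (mul_le_of_le_one_left (hpos t htt).le hle) (hf t)
    have h2 : ((t : ℝ) + N) * (A t * x ^ t * (c * x ^ N * ρ t)) ≤ (t + N) * (A t * x ^ t * ρ t) :=
      mul_le_mul_of_nonneg_left h1 (by positivity)
    nlinarith [mul_le_mul_of_nonneg_left ht.le (hf t)]

theorem seriesConverges_iff_summable (μ r z : ℂ) :
    SeriesConverges μ r z ↔ Summable fun t => ‖coeff μ r t‖ * ‖z‖ ^ t := by
  simp only [SeriesConverges, norm_mul, norm_pow]

/-! ### Recurrences of the coefficients with a fixed step -/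

/-- The falling factorial `x (x - 1) ⋯ (x - k + 1)`. -/
def falling (x : ℂ) (k : ℕ) : ℂ := ∏ i ∈ Finset.range k, (x - i)

theorem falling_add (x : ℂ) (k l : ℕ) : falling x (k + l) = falling x k * falling (x - k) l := by
  unfold falling
  rw [Finset.prod_range_add]
  congr 1
  refine Finset.prod_congr rfl fun i _ => ?_
  push_cast; ring

theorem falling_eq_rising (x : ℂ) (k : ℕ) : falling (x + k - 1) k = rising x k := by
  unfold falling rising
  rw [← Finset.prod_range_reflect]
  refine Finset.prod_congr rfl fun i hi => ?_
  have : i + 1 ≤ k := Finset.mem_range.1 hi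
  rw [show k - 1 - i = k - (i + 1) by omega, Nat.cast_sub this]
  push_cast; ring

theorem falling_eq_neg (x : ℂ) (k : ℕ) : falling x k = (-1) ^ k * rising (-x) k := by
  unfold falling rising
  conv_rhs => rw [← Finset.card_range k, ← Finset.prod_const, Finset.card_range,
    ← Finset.prod_mul_distrib]
  exact Finset.prod_congr rfl fun i _ => by ring

theorem factorial_add (t k : ℕ) :
    ((t + k).factorial : ℂ) = t.factorial * rising ((t : ℂ) + 1) k := by
  rw [← Nat.factorial_mul_ascFactorial, Nat.ascFactorial_eq_prod_range]
  unfold rising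
  push_cast
  rfl

theorem rising_natCast_add_one_ne_zero (t k : ℕ) : rising ((t : ℂ) + 1) k ≠ 0 := by
  have h : ((t + k).factorial : ℂ) ≠ 0 := Nat.cast_ne_zero.2 (t + k).factorial_ne_zero
  rw [factorial_add] at h
  exact right_ne_zero_of_mul h

theorem coeff_eq_falling {μ r : ℂ} {t : ℕ} (s : ℕ) (ht : t = s + 1) :
    coeff μ r t = r / (t.factorial : ℂ) * falling (t * μ + r - 1) s := by
  subst ht
  rw [coeff_succ, falling]
  push_cast
  rfl

/-- Passing from `t` to `t + m + n` moves `x = tμ + r` to `x + n`. The falling factorial gains `n`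
factors at the top and `m` at the bottom; the latter, with signs reversed, form a rising factorial
in `t - x`. -/
theorem coeff_add_step_of_lt_one {m n : ℕ} {μ r : ℂ} (hμ : ((m : ℂ) + n) * μ = n) {t : ℕ}
    (ht : 1 ≤ t) :
    coeff μ r (t + (m + n)) * rising ((t : ℂ) + 1) (m + n) =
      coeff μ r t * (rising (t * μ + r) n * ((-1) ^ m * rising (t - (t * μ + r)) m)) := by
  obtain ⟨s, rfl⟩ := Nat.exists_eq_add_of_le' ht
  rw [coeff_eq_falling (n + (s + m)) (by ring), coeff_eq_falling s rfl, factorial_add]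
  have h0 : ((s + 1).factorial : ℂ) ≠ 0 := by exact_mod_cast (s + 1).factorial_ne_zero
  have h1 : rising (((s + 1 : ℕ) : ℂ) + 1) (m + n) ≠ 0 :=
    rising_natCast_add_one_ne_zero _ _
  set x : ℂ := ((s + 1 : ℕ) : ℂ) * μ + r with hx
  have h2 : ((s + 1 + (m + n) : ℕ) : ℂ) * μ + r - 1 = x + n - 1 := by
    rw [hx]; push_cast; linear_combination hμ
  rw [h2, falling_add, falling_eq_rising, show x + n - 1 - n = x - 1 by ring, falling_add,
    falling_eq_neg (x - 1 - s), show -(x - 1 - s) = ((s + 1 : ℕ) : ℂ) - x by push_cast; ring]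
  field_simp

/-- Here the top gains `m + n` factors while the length grows only by `n`, so `m` factors are lost
at the bottom. They are moved to the left side to avoid a division. -/
theorem coeff_add_step_of_one_lt {m n : ℕ} {μ r : ℂ} (hμ : (n : ℂ) * μ = (m : ℂ) + n) {t : ℕ}
    (ht : 1 ≤ t) :
    coeff μ r (t + n) * (rising ((t : ℂ) + 1) n * rising (t * μ + r - t + 1) m) =
      coeff μ r t * rising (t * μ + r) (m + n) := by
  obtain ⟨s, rfl⟩ := Nat.exists_eq_add_of_le' ht
  rw [coeff_eq_falling (s + n) (by ring), coeff_eq_falling s rfl, factorial_add]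
  have h0 : ((s + 1).factorial : ℂ) ≠ 0 := by exact_mod_cast (s + 1).factorial_ne_zero
  have h1 : rising (((s + 1 : ℕ) : ℂ) + 1) n ≠ 0 :=
    rising_natCast_add_one_ne_zero _ _
  set x : ℂ := ((s + 1 : ℕ) : ℂ) * μ + r with hx
  have h2 : ((s + 1 + n : ℕ) : ℂ) * μ + r - 1 = x + (m + n : ℕ) - 1 := by
    rw [hx]; push_cast; linear_combination hμ
  -- One falling factorial of length `s + n + m` is split in two ways.
  have h3 := falling_add (x + (m + n : ℕ) - 1) (s + n) m
  rw [show s + n + m = (m + n) + s by ring, falling_add, falling_eq_rising,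
    show x + (m + n : ℕ) - 1 - (m + n : ℕ) = x - 1 by ring,
    show x + (m + n : ℕ) - 1 - (s + n : ℕ) = x - (s + 1 : ℕ) + 1 + m - 1 by push_cast; ring,
    falling_eq_rising] at h3
  rw [h2]
  field_simp
  rw [mul_assoc, ← h3]
  ring

/-! ### Domains of convergence of the three series -/

theorem bound_pos {m n : ℕ} (hm : 1 ≤ m) (hn : 1 ≤ n) : 0 < bound m n := by
  unfold bound; positivity

theorem bound_comm (m n : ℕ) : bound m n = bound n m := by
  unfold bound; rw [add_comm n m, add_comm (n : ℝ) m, mul_comm]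

/-- A vanishing factor would give `(m+n)(j-n) = 1` in the integers, although `m + n ≥ 2`. -/
theorem coeff_period_ne_zero {m n : ℕ} (hm : 1 ≤ m) (hn : 1 ≤ n) :
    coeff ((n : ℂ) / ((m : ℂ) + n)) (1 / ((m : ℂ) + n)) (m + n) ≠ 0 := by
  have hq : ((m : ℂ) + n) ≠ 0 := by exact_mod_cast (by omega : m + n ≠ 0)
  rw [coeff, if_neg (by omega)]
  refine mul_ne_zero (div_ne_zero (one_div_ne_zero hq)
    (Nat.cast_ne_zero.2 (Nat.factorial_ne_zero _))) (Finset.prod_ne_zero_iff.2 fun j _ h => ?_)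
  push_cast at h
  rw [mul_div_cancel₀ _ hq] at h
  have h1 : ((m : ℂ) + n) * (j - n) = 1 := by
    have : (j : ℂ) - n = 1 / ((m : ℂ) + n) := by linear_combination -h
    rw [this, mul_one_div_cancel hq]
  have h2 : ((m + n : ℕ) : ℤ) * (j - n) = 1 := by exact_mod_cast h1
  have h3 := Int.eq_one_or_neg_one_of_mul_eq_one h2
  omega

theorem seriesConverges_iff_of_lt_one {m n : ℕ} (hm : 1 ≤ m) (hn : 1 ≤ n) (z : ℂ) :
    SeriesConverges ((n : ℂ) / ((m : ℂ) + n)) (1 / ((m : ℂ) + n)) z ↔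
      bound m n * ‖z‖ ^ (m + n) ≤ 1 := by
  have hm0 : (0 : ℝ) < m := by exact_mod_cast hm
  have hn0 : (0 : ℝ) < n := by exact_mod_cast hn
  have hm1 : (1 : ℝ) ≤ m := by exact_mod_cast hm
  have hq0 : ((m : ℂ) + n) ≠ 0 := by exact_mod_cast (by omega : m + n ≠ 0)
  set κ : ℝ := n / ((m : ℝ) + n) with hκ
  set κ' : ℝ := m / ((m : ℝ) + n) with hκ'
  set r : ℝ := 1 / ((m : ℝ) + n) with hr
  have hκ0 : 0 < κ := by positivity
  have hκ'0 : 0 < κ' := by positivity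
  have hr0 : 0 < r := by positivity
  have hΛ : κ ^ n * κ' ^ m = bound m n := by
    rw [hκ, hκ', bound, div_pow, div_pow, pow_add]; field_simp
  have hrate := ((hasRate_rising hκ0 r n).mul (hasRate_rising hκ'0 (-r) m)).mul
    (hasRate_rising one_pos 1 (m + n)).inv
  -- The contributions of `r` cancel, since `n/κ = m/κ' = m + n`.
  have hα : (n * r + n * ((n : ℝ) - 1) / 2) / κ + (m * -r + m * ((m : ℝ) - 1) / 2) / κ' +
      -((((m + n : ℕ) : ℝ) * 1 + (m + n : ℕ) * (((m + n : ℕ) : ℝ) - 1) / 2) / 1) =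
      -(3 * ((m + n : ℕ) : ℝ) / 2) := by
    rw [hκ, hκ', hr]; push_cast; field_simp; ring
  rw [hα] at hrate
  have hx : ∀ t : ℕ, m + n ≤ t → 0 < κ * t + r ∧ 0 < κ' * t + -r ∧ (0 : ℝ) < t := by
    intro t ht
    have ht2 : (2 : ℝ) ≤ t := by exact_mod_cast (by omega : 2 ≤ t)
    refine ⟨by positivity, ?_, by positivity⟩
    have : κ' * t + -r = (m * t - 1) / ((m : ℝ) + n) := by rw [hκ', hr]; ring
    rw [this]
    exact div_pos (by nlinarith) (by positivity)
  rw [seriesConverges_iff_summable, ← hΛ]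
  -- The start cannot be `t = 1`: for `m = 1` the factor `κ' t - r = (mt - 1)/(m+n)` vanishes there,
  -- and so does the rest of that residue class.
  refine summable_iff_of_ratio (fun _ => norm_nonneg _) (by omega) (by positivity) hrate
    (t₀ := m + n) (norm_pos_iff.2 (coeff_period_ne_zero hm hn)) ?_ ?_ (norm_nonneg z)
  · intro t ht
    obtain ⟨h1, h2, h3⟩ := hx t ht
    have := rising_pos h1 n
    have := rising_pos h2 m
    have := rising_pos (show (0 : ℝ) < 1 * t + 1 by positivity) (m + n)
    positivity
  · intro t ht
    obtain ⟨h1, h2, h3⟩ := hx t ht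
    have h4 : (0 : ℝ) < 1 * t + 1 := by positivity
    have h := congrArg norm (coeff_add_step_of_lt_one (r := 1 / ((m : ℂ) + n))
      (mul_div_cancel₀ (n : ℂ) hq0) (show 1 ≤ t by omega))
    have e1 : (t : ℂ) * (n / ((m : ℂ) + n)) + 1 / ((m : ℂ) + n) = ((κ * t + r : ℝ) : ℂ) := by
      rw [hκ, hr]; push_cast; ring
    have e2 : (t : ℂ) - ((κ * t + r : ℝ) : ℂ) = ((κ' * t + -r : ℝ) : ℂ) := by
      rw [hκ, hκ', hr]; push_cast; field_simp; ring
    have e3 : (t : ℂ) + 1 = ((1 * t + 1 : ℝ) : ℂ) := by push_cast; ring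
    rw [e1, e2, e3, norm_mul, norm_mul, norm_mul, norm_mul, norm_rising h1, norm_rising h2,
      norm_rising h4] at h
    simp only [norm_pow, norm_neg, norm_one, one_pow, one_mul] at h
    have h5 := rising_pos h4 (m + n)
    rw [one_mul] at h5
    simp only [one_mul]
    rw [eq_div_of_mul_eq h5.ne' h, mul_pow, mul_pow]
    have h6 : κ ≠ 0 := hκ0.ne'
    have h7 : κ' ≠ 0 := hκ'0.ne'
    field_simp
    ring

/-- Negative `r ≥ -1` is admitted because the reflected third series has `r = -1/m`. For `t ≥ 1`
this still keeps every rising factorial positive. -/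
theorem seriesConverges_iff_of_one_lt {m n : ℕ} (hm : 1 ≤ m) (hn : 1 ≤ n) {r : ℝ} (hr : r ≠ 0)
    (hr1 : -1 ≤ r) (z : ℂ) :
    SeriesConverges (((m : ℂ) + n) / n) r z ↔ ‖z‖ ^ n ≤ bound m n := by
  have hm0 : (0 : ℝ) < m := by exact_mod_cast hm
  have hn0 : (0 : ℝ) < n := by exact_mod_cast hn
  have hn0' : (n : ℂ) ≠ 0 := Nat.cast_ne_zero.2 (by omega)
  set κ : ℝ := ((m : ℝ) + n) / n with hκ
  set κ' : ℝ := (m : ℝ) / n with hκ'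
  have hκ0 : 0 < κ := by positivity
  have hκ'0 : 0 < κ' := by positivity
  have hκκ' : κ = κ' + 1 := by rw [hκ, hκ']; field_simp
  have hΛ : κ ^ (m + n) / κ' ^ m = (bound m n)⁻¹ := by
    rw [hκ, hκ', bound, div_pow, div_pow, pow_add (n : ℝ)]; field_simp
  have hrate := ((hasRate_rising hκ0 r (m + n)).mul (hasRate_rising hκ'0 (r + 1) m).inv).mul
    (hasRate_rising one_pos 1 n).inv
  -- Again `r` drops out: `(m+n) r/κ = n r` and `m (r+1)/κ' = n (r+1)`.
  have hα : (((m + n : ℕ) : ℝ) * r + (m + n : ℕ) * (((m + n : ℕ) : ℝ) - 1) / 2) / κ +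
      -((m * (r + 1) + m * ((m : ℝ) - 1) / 2) / κ') +
      -(((n : ℝ) * 1 + n * ((n : ℝ) - 1) / 2) / 1) =
      -(3 * (n : ℝ) / 2) := by
    rw [hκ, hκ']; push_cast; field_simp; ring
  rw [hα] at hrate
  have hx : ∀ t : ℕ, 1 ≤ t → 0 < κ * t + r ∧ 0 < κ' * t + (r + 1) ∧ (0 : ℝ) < t := by
    intro t ht
    have ht1 : (1 : ℝ) ≤ t := by exact_mod_cast ht
    have : 0 < κ' * t := by positivity
    refine ⟨?_, by linarith, by linarith⟩
    rw [hκκ']; linarith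
  have hb := bound_pos hm hn
  rw [seriesConverges_iff_summable]
  have hiff : (bound m n)⁻¹ * ‖z‖ ^ n ≤ 1 ↔ ‖z‖ ^ n ≤ bound m n := by
    rw [inv_mul_le_iff₀ hb, mul_one]
  rw [← hiff, ← hΛ]
  refine summable_iff_of_ratio (fun _ => norm_nonneg _) hn (by positivity) hrate
    (t₀ := 1) (norm_pos_iff.2 (by simpa [coeff] using hr)) ?_ ?_ (norm_nonneg z)
  · intro t ht
    obtain ⟨h1, h2, h3⟩ := hx t ht
    have := rising_pos h1 (m + n)
    have := rising_pos h2 m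
    have := rising_pos (show (0 : ℝ) < 1 * t + 1 by positivity) n
    positivity
  · intro t ht
    obtain ⟨h1, h2, h3⟩ := hx t ht
    have h4 : (0 : ℝ) < 1 * t + 1 := by positivity
    have h := congrArg norm (coeff_add_step_of_one_lt (r := r)
      (mul_div_cancel₀ ((m : ℂ) + n) hn0') ht)
    have e1 : (t : ℂ) * (((m : ℂ) + n) / n) + r = ((κ * t + r : ℝ) : ℂ) := by
      rw [hκ]; push_cast; ring
    have e2 : ((κ * t + r : ℝ) : ℂ) - t + 1 = ((κ' * t + (r + 1) : ℝ) : ℂ) := by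
      rw [hκκ']; push_cast; ring
    have e3 : (t : ℂ) + 1 = ((1 * t + 1 : ℝ) : ℂ) := by push_cast; ring
    rw [e1, e2, e3, norm_mul, norm_mul, norm_mul, norm_rising h1, norm_rising h2,
      norm_rising h4] at h
    have h5 := rising_pos h4 n
    have h6 := rising_pos h2 m
    rw [one_mul] at h5 h
    simp only [one_mul]
    rw [eq_div_of_mul_eq (mul_pos h5 h6).ne' h, mul_pow, mul_pow]
    have h7 : κ ≠ 0 := hκ0.ne'
    have h8 : κ' ≠ 0 := hκ'0.ne'
    field_simp
    ring

theorem seriesConverges_iff_of_neg {m n : ℕ} (hm : 1 ≤ m) (hn : 1 ≤ n) (z : ℂ) :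
    SeriesConverges (-(n : ℂ) / m) (1 / (m : ℂ)) z ↔ ‖z‖ ^ m ≤ bound m n := by
  have hm0 : (m : ℂ) ≠ 0 := Nat.cast_ne_zero.2 (by omega)
  have hm1 : (1 : ℝ) ≤ m := by exact_mod_cast hm
  have h := seriesConverges_iff_of_one_lt hn hm (r := -(1 / (m : ℝ))) (by
    have : (0 : ℝ) < 1 / m := by positivity
    linarith) (by
    have : 1 / (m : ℝ) ≤ 1 := by rw [div_le_one (by positivity)]; exact hm1
    linarith) z
  rw [bound_comm, ← h, seriesConverges_iff_summable, seriesConverges_iff_summable]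
  have : ∀ t, ‖coeff (-(n : ℂ) / m) (1 / (m : ℂ)) t‖ =
      ‖coeff (((n : ℂ) + m) / m) ((-(1 / (m : ℝ)) : ℝ) : ℂ) t‖ := by
    intro t
    have h1 := coeff_one_sub (((n : ℂ) + m) / m) ((-(1 / (m : ℝ)) : ℝ) : ℂ) t
    rw [show 1 - ((n : ℂ) + m) / m = -(n : ℂ) / m by field_simp; ring,
      show -((-(1 / (m : ℝ)) : ℝ) : ℂ) = 1 / (m : ℂ) by push_cast; ring] at h1
    rw [h1]; simp
  simp only [this]

/-! ### Analyticity of the series and the identity theorem -/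

theorem norm_term_le {μ r z w : ℂ} (h : ‖w‖ ≤ ‖z‖) (t : ℕ) :
    ‖coeff μ r t * w ^ t‖ ≤ ‖coeff μ r t * z ^ t‖ := by
  rw [norm_mul, norm_mul, norm_pow, norm_pow]
  gcongr

theorem SeriesConverges.differentiableOn {μ r z : ℂ} (hz : SeriesConverges μ r z) :
    DifferentiableOn ℂ (series μ r) (Metric.ball 0 ‖z‖) :=
  Complex.differentiableOn_tsum_of_summable_norm hz (fun _ => by fun_prop) Metric.isOpen_ball
    fun _ _ hw => norm_term_le (mem_ball_zero_iff.1 hw).le _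

/-- Absolute convergence at one point of the circle majorizes the series on the whole closed disc.
-/
theorem SeriesConverges.continuousOn {μ r z : ℂ} (hz : SeriesConverges μ r z) :
    ContinuousOn (series μ r) (Metric.closedBall 0 ‖z‖) :=
  continuousOn_tsum (fun _ => by fun_prop) hz
    fun _ _ hw => norm_term_le (mem_closedBall_zero_iff.1 hw) _

theorem SeriesConverges.diffContOnCl {μ r z : ℂ} (hz : SeriesConverges μ r z) :
    DiffContOnCl ℂ (series μ r) (Metric.ball 0 ‖z‖) :=
  ⟨hz.differentiableOn, hz.continuousOn.mono Metric.closure_ball_subset_closedBall⟩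

/-- A family of functions that are roots of monic polynomials and pairwise distinct near `0` gives
all roots wherever everything is continued analytically. -/
theorem eq_prod_of_distinct_near_zero {ι : Type*} [Fintype ι] {ρ : ℝ} (hρ : 0 < ρ)
    {p : ℂ → ℂ[X]} {f : ι → ℂ → ℂ} (hmonic : ∀ s, (p s).Monic)
    (hdeg : ∀ s, (p s).natDegree = Fintype.card ι)
    (hp : ∀ x, DiffContOnCl ℂ (fun s => (p s).eval x) (Metric.ball 0 ρ))
    (hf : ∀ i, DiffContOnCl ℂ (f i) (Metric.ball 0 ρ))
    (hroot : ∀ i, ∀ s ∈ Metric.ball (0 : ℂ) ρ, (p s).IsRoot (f i s))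
    (hinj : ∀ᶠ s in 𝓝[≠] (0 : ℂ), Function.Injective fun i => f i s) {s : ℂ} (hs : ‖s‖ ≤ ρ) :
    p s = ∏ i, (X - C (f i s)) := by
  have hnear : ∀ᶠ s in 𝓝[≠] (0 : ℂ), p s = ∏ i, (X - C (f i s)) := by
    filter_upwards [hinj, mem_nhdsWithin_of_mem_nhds (Metric.ball_mem_nhds (0 : ℂ) hρ)]
      with s hs hsρ
    have hle : Finset.univ.val.map (fun i => f i s) ≤ (p s).roots := by
      rw [Multiset.le_iff_subset (Finset.univ.nodup.map hs)]
      intro x hx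
      obtain ⟨i, -, rfl⟩ := Multiset.mem_map.1 hx
      exact (mem_roots (hmonic s).ne_zero).2 (hroot i s hsρ)
    -- Distinct roots, as many as the degree, exhaust the root multiset.
    have heq := Multiset.eq_of_le_of_card_le hle (by
      rw [Multiset.card_map]
      exact (card_roots' _).trans_eq (hdeg s))
    have hcard : Multiset.card (p s).roots = (p s).natDegree := by
      rw [← heq, Multiset.card_map, hdeg]; rfl
    rw [← prod_multiset_X_sub_C_of_monic_of_roots_card_eq (hmonic s) hcard, ← heq,
      Multiset.map_map]
    rfl
  -- Evaluating at a fixed `x` reduces the claim to scalar analytic functions of `s`.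
  refine Polynomial.funext fun x => ?_
  have hprod : DiffContOnCl ℂ (fun s => (∏ i, (X - C (f i s))).eval x) (Metric.ball 0 ρ) := by
    simp only [eval_prod, eval_sub, eval_X, eval_C]
    refine ⟨DifferentiableOn.fun_finsetProd fun i _ => (hf i).1.const_sub x, ?_⟩
    exact continuousOn_finsetProd _ fun i _ => continuousOn_const.sub (hf i).2
  have hopen : Set.EqOn (fun s => (p s).eval x) (fun s => (∏ i, (X - C (f i s))).eval x)
      (Metric.ball 0 ρ) := by
    refine AnalyticOnNhd.eqOn_of_preconnected_of_frequently_eq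
      ((hp x).1.analyticOnNhd Metric.isOpen_ball) (hprod.1.analyticOnNhd Metric.isOpen_ball)
      (convex_ball _ _).isPreconnected (Metric.mem_ball_self hρ) ?_
    exact (hnear.mono fun s hs => by rw [hs]).frequently
  refine hopen.of_subset_closure (hp x).2 hprod.2 subset_closure subset_rfl ?_
  rw [closure_ball _ hρ.ne']
  exact mem_closedBall_zero_iff.2 hs

theorem eventually_injective {ι : Type*} [Finite ι] {l : Filter ℂ} {f : ι → ℂ → ℂ} {c : ι → ℂ}
    (hf : ∀ i, Tendsto (f i) l (𝓝 (c i))) (hc : Function.Injective c) :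
    ∀ᶠ s in l, Function.Injective fun i => f i s := by
  have h : ∀ i j, i ≠ j → ∀ᶠ s in l, f i s ≠ f j s := fun i j hij =>
    ((hf i).sub (hf j)).eventually_ne (sub_ne_zero.2 (hc.ne hij)) |>.mono fun s hs =>
      sub_ne_zero.1 hs
  have h' : ∀ᶠ s in l, ∀ i j, i ≠ j → f i s ≠ f j s := by
    simp only [eventually_all]
    exact h
  exact h'.mono fun s hs i j hij => by_contra fun hne => hs i j hne hij

/-! ### Phases and powers -/

theorem phase_ne_zero (ℓ : ℕ) (s : ℂ) : phase ℓ s ≠ 0 := Complex.exp_ne_zero _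

theorem phase_pow (ℓ : ℕ) (s : ℂ) (k : ℕ) : phase ℓ s ^ k = phase ℓ (k * s) := by
  rw [phase, phase, ← Complex.exp_nat_mul]; congr 1; ring

theorem phase_neg (ℓ : ℕ) (s : ℂ) : phase ℓ (-s) = (phase ℓ s)⁻¹ := by
  rw [phase, phase, ← Complex.exp_neg]; congr 1; ring

theorem phase_one (ℓ : ℕ) : phase ℓ 1 = -1 := by
  rw [phase, show Complex.I * (Real.pi : ℂ) * (2 * (ℓ : ℂ) + 1) * 1 =
    Real.pi * Complex.I + ℓ * (2 * Real.pi * Complex.I) by ring,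
    Complex.exp_add, Complex.exp_nat_mul_two_pi_mul_I, Complex.exp_pi_mul_I, mul_one]

theorem norm_phase (ℓ : ℕ) (s : ℝ) : ‖phase ℓ s‖ = 1 := by
  rw [phase, show Complex.I * (Real.pi : ℂ) * (2 * (ℓ : ℂ) + 1) * s =
    ((Real.pi * (2 * ℓ + 1) * s : ℝ) : ℂ) * Complex.I by push_cast; ring]
  exact Complex.norm_exp_ofReal_mul_I _

theorem phase_one_div_pow (ℓ : ℕ) {k : ℕ} (hk : k ≠ 0) : phase ℓ (1 / (k : ℂ)) ^ k = -1 := by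
  rw [phase_pow, mul_one_div_cancel (Nat.cast_ne_zero.2 hk), phase_one]

theorem phase_one_div_injective {k : ℕ} (hk : k ≠ 0) :
    Function.Injective fun ℓ : Fin k => phase ℓ (1 / (k : ℂ)) := by
  have hprim := Complex.isPrimitiveRoot_exp k hk
  have h : ∀ ℓ : ℕ, phase ℓ (1 / (k : ℂ)) =
      Complex.exp (Real.pi * Complex.I / k) * Complex.exp (2 * Real.pi * Complex.I / k) ^ ℓ := by
    intro ℓ
    rw [← Complex.exp_nat_mul, ← Complex.exp_add, phase]
    congr 1; ring
  intro i j hij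
  simp only [h] at hij
  exact Fin.ext (hprim.pow_inj i.2 j.2 (mul_left_cancel₀ (Complex.exp_ne_zero _) hij))

theorem powBy_zero {L : ℂ → ℂ} {s : ℂ} (hs : s ≠ 0) : powBy L 0 s = 0 := by
  simp [powBy, hs]

theorem powBy_ne_zero (L : ℂ → ℂ) {z : ℂ} (hz : z ≠ 0) (s : ℂ) : powBy L z s ≠ 0 := by
  simp [powBy, hz]

theorem powBy_pow (L : ℂ → ℂ) {z : ℂ} (hz : z ≠ 0) (s : ℂ) (k : ℕ) :
    powBy L z s ^ k = powBy L z (k * s) := by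
  rw [powBy, powBy, if_neg hz, if_neg hz, ← Complex.exp_nat_mul]; congr 1; ring

theorem powBy_div (L : ℂ → ℂ) {z : ℂ} (hz : z ≠ 0) (j k : ℕ) :
    powBy L z ((j : ℂ) / k) = powBy L z (1 / (k : ℂ)) ^ j := by
  rw [powBy_pow L hz, mul_one_div]

theorem powBy_one {L : ℂ → ℂ} (hL : IsLogChoice L) (z : ℂ) : powBy L z 1 = z := by
  rcases eq_or_ne z 0 with rfl | hz
  · exact powBy_zero one_ne_zero
  · simp [powBy, hz, hL z hz]

theorem powBy_one_div_pow {L : ℂ → ℂ} (hL : IsLogChoice L) (z : ℂ) {k : ℕ} (hk : k ≠ 0) :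
    powBy L z (1 / (k : ℂ)) ^ k = z := by
  have hk' : (k : ℂ) ≠ 0 := Nat.cast_ne_zero.2 hk
  rcases eq_or_ne z 0 with rfl | hz
  · rw [powBy_zero (one_div_ne_zero hk'), zero_pow hk]
  · rw [powBy_pow L hz, mul_one_div_cancel hk', powBy_one hL]

/-- For real `s` only `Re L(z) = log |z|` enters, so the convergence criteria do not depend on the
branch. -/
theorem norm_powBy {L : ℂ → ℂ} (hL : IsLogChoice L) (z : ℂ) {s : ℝ} (hs : s ≠ 0) :
    ‖powBy L z s‖ = ‖z‖ ^ s := by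
  rcases eq_or_ne z 0 with rfl | hz
  · rw [powBy_zero (by exact_mod_cast hs), norm_zero, Real.zero_rpow hs]
  · rw [powBy, if_neg hz, Complex.norm_exp, Complex.re_ofReal_mul, mul_comm, Real.exp_mul,
      ← Complex.norm_exp, hL z hz]

/-! ### The trinomial -/

theorem trinomial_tail_degree_lt {m n : ℕ} (hm : 1 ≤ m) (hn : 1 ≤ n) (a b : ℂ) :
    (C a * X ^ n + C b : ℂ[X]).degree < ((m + n : ℕ) : WithBot ℕ) := by
  refine (degree_add_le _ _).trans_lt (max_lt ?_ ?_)
  · exact (degree_C_mul_X_pow_le n a).trans_lt (by exact_mod_cast (by omega))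
  · exact degree_C_le.trans_lt (by exact_mod_cast (by omega))

theorem trinomial_monic {m n : ℕ} (hm : 1 ≤ m) (hn : 1 ≤ n) (a b : ℂ) :
    (trinomial m n a b).Monic := by
  rw [trinomial, add_assoc]
  exact monic_X_pow_add (trinomial_tail_degree_lt hm hn a b)

theorem trinomial_natDegree {m n : ℕ} (hm : 1 ≤ m) (hn : 1 ≤ n) (a b : ℂ) :
    (trinomial m n a b).natDegree = m + n := by
  rw [trinomial, add_assoc]
  refine natDegree_eq_of_degree_eq_some ?_
  rw [degree_add_eq_left_of_degree_lt, degree_X_pow]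
  rw [degree_X_pow]
  exact trinomial_tail_degree_lt hm hn a b

theorem eval_trinomial (m n : ℕ) (a b x : ℂ) :
    (trinomial m n a b).eval x = x ^ (m + n) + a * x ^ n + b := by
  simp [trinomial]

theorem roots_prod_fin (k : ℕ) (f : ℕ → ℂ) :
    (∏ i : Fin k, (X - C (f i))).roots = family k f := by
  rw [Fin.prod_univ_eq_prod_range (fun i => X - C (f i)) k, family,
    ← roots_multiset_prod_X_sub_C ((Multiset.range k).map f), Multiset.map_map]
  rfl

theorem roots_prod_sum (k l : ℕ) (f g : ℕ → ℂ) :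
    ((∏ i : Fin k, (X - C (f i))) * ∏ i : Fin l, (X - C (g i))).roots =
      family k f + family l g := by
  have h : ∀ (k : ℕ) (f : ℕ → ℂ), (∏ i : Fin k, (X - C (f i))) ≠ 0 := fun k f =>
    Finset.prod_ne_zero_iff.2 fun i _ => X_sub_C_ne_zero _
  rw [roots_mul (mul_ne_zero (h k f) (h l g)), roots_prod_fin, roots_prod_fin]

theorem rpow_div_pow {x : ℝ} (hx : 0 ≤ x) (j : ℕ) {k : ℕ} (hk : k ≠ 0) :
    (x ^ ((j : ℝ) / k)) ^ k = x ^ j := by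
  rw [← Real.rpow_natCast, ← Real.rpow_mul hx, div_mul_cancel₀ _ (Nat.cast_ne_zero.2 hk),
    Real.rpow_natCast]

theorem rpow_neg_div_pow {x : ℝ} (hx : 0 ≤ x) (j : ℕ) {k : ℕ} (hk : k ≠ 0) :
    (x ^ (-(j : ℝ) / k)) ^ k = (x ^ j)⁻¹ := by
  rw [neg_div, Real.rpow_neg hx, inv_pow, rpow_div_pow hx j hk]

theorem rpow_add_div_pow {x : ℝ} (hx : 0 ≤ x) (i j : ℕ) {k : ℕ} (hk : k ≠ 0) :
    (x ^ (((i : ℝ) + j) / k)) ^ k = x ^ (i + j) := by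
  rw [← Nat.cast_add, rpow_div_pow hx _ hk]

theorem diffContOnCl_series_comp {μ r z : ℂ} (hz : SeriesConverges μ r z) {g : ℂ → ℂ}
    (hg : Differentiable ℂ g) {ρ : ℝ} (hgz : ∀ w ∈ Metric.ball (0 : ℂ) ρ, ‖g w‖ < ‖z‖) :
    DiffContOnCl ℂ (fun w => series μ r (g w)) (Metric.ball 0 ρ) :=
  hz.diffContOnCl.comp hg.diffContOnCl fun w hw => mem_ball_zero_iff.2 (hgz w hw)

theorem continuousAt_zero_of_diffContOnCl {f : ℂ → ℂ} {ρ : ℝ} (hρ : 0 < ρ)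
    (hf : DiffContOnCl ℂ f (Metric.ball 0 ρ)) : ContinuousAt f 0 :=
  (hf.1.differentiableAt (Metric.ball_mem_nhds 0 hρ)).continuousAt

/-! ### The first series -/

theorem norm_arg1 {L : ℂ → ℂ} (hL : IsLogChoice L) {m n : ℕ} (hm : 1 ≤ m) (hn : 1 ≤ n)
    (a b : ℂ) (ℓ : ℕ) :
    ‖arg1 L m n a b ℓ‖ = ‖a‖ / ‖b‖ ^ ((m : ℝ) / ((m : ℝ) + n)) := by
  have h1 := norm_phase ℓ ((n : ℝ) / ((m : ℝ) + n))
  have h2 := norm_powBy hL b (show (m : ℝ) / ((m : ℝ) + n) ≠ 0 by positivity)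
  push_cast at h1 h2
  rw [arg1, norm_mul, norm_div, h1, h2, one_mul]

theorem norm_arg1_pow {L : ℂ → ℂ} (hL : IsLogChoice L) {m n : ℕ} (hm : 1 ≤ m) (hn : 1 ≤ n)
    (a b : ℂ) (ℓ : ℕ) :
    ‖arg1 L m n a b ℓ‖ ^ (m + n) = ‖a‖ ^ (m + n) / ‖b‖ ^ m := by
  rw [norm_arg1 hL hm hn, div_pow, ← Nat.cast_add, rpow_div_pow (norm_nonneg _) _ (by omega)]

theorem converges1_iff {L : ℂ → ℂ} {m n : ℕ} (hm : 1 ≤ m) (hn : 1 ≤ n)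
    (a b : ℂ) (ℓ : ℕ) :
    Converges1 L m n a b ℓ ↔ bound m n * ‖arg1 L m n a b ℓ‖ ^ (m + n) ≤ 1 :=
  seriesConverges_iff_of_lt_one hm hn _

theorem converges1_iff_le {L : ℂ → ℂ} (hL : IsLogChoice L) {m n : ℕ} (hm : 1 ≤ m) (hn : 1 ≤ n)
    (a b : ℂ) (ℓ : ℕ) :
    Converges1 L m n a b ℓ ↔ ‖a‖ / ‖b‖ ^ ((m : ℝ) / ((m : ℝ) + n)) ≤
      ((m : ℝ) + n) /
        ((n : ℝ) ^ ((n : ℝ) / ((m : ℝ) + n)) * (m : ℝ) ^ ((m : ℝ) / ((m : ℝ) + n))) := by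
  rw [converges1_iff hm hn, ← norm_arg1 hL hm hn a b ℓ]
  set v : ℝ := ((m : ℝ) + n) /
    ((n : ℝ) ^ ((n : ℝ) / ((m : ℝ) + n)) * (m : ℝ) ^ ((m : ℝ) / ((m : ℝ) + n))) with hv
  have hv0 : 0 ≤ v := by positivity
  have hvq : v ^ (m + n) = (bound m n)⁻¹ := by
    rw [hv, div_pow, mul_pow, ← Nat.cast_add, rpow_div_pow (Nat.cast_nonneg _) _ (by omega),
      rpow_div_pow (Nat.cast_nonneg _) _ (by omega), bound, inv_div, mul_comm ((n : ℝ) ^ n)]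
    push_cast; rfl
  rw [← pow_le_pow_iff_left₀ (norm_nonneg _) hv0 (show m + n ≠ 0 by omega), hvq,
    ← one_div, le_div_iff₀ (bound_pos hm hn), mul_comm]

theorem converges1_iff_bound_le {L : ℂ → ℂ} (hL : IsLogChoice L) {m n : ℕ} (hm : 1 ≤ m) (hn : 1 ≤ n)
    {a b : ℂ} (hb : b ≠ 0) (ha : a ≠ 0) (ℓ : ℕ) :
    Converges1 L m n a b ℓ ↔ bound m n ≤ ‖b‖ ^ m / ‖a‖ ^ (m + n) := by
  have hb' : 0 < ‖b‖ := norm_pos_iff.2 hb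
  have ha' : 0 < ‖a‖ := norm_pos_iff.2 ha
  rw [converges1_iff hm hn, norm_arg1_pow hL hm hn, le_div_iff₀ (by positivity), ← mul_div_assoc,
    div_le_one (by positivity)]

theorem isRoot_root1 {L : ℂ → ℂ} (hL : IsLogChoice L) {m n : ℕ} (hm : 1 ≤ m) (hn : 1 ≤ n)
    {a b : ℂ} (hb : b ≠ 0) {ℓ : ℕ} (h : Converges1 L m n a b ℓ) :
    (trinomial m n a b).IsRoot (root1 L m n a b ℓ) := by
  have hq : m + n ≠ 0 := by omega
  unfold Converges1 at h
  rw [IsRoot, eval_trinomial, root1]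
  rw [← Nat.cast_add] at h ⊢
  have hy := series_pow_eq hq h
  set y := series ((n : ℂ) / (m + n : ℕ)) (1 / ((m + n : ℕ) : ℂ)) (arg1 L m n a b ℓ)
  have hz : arg1 L m n a b ℓ = phase ℓ (1 / ((m + n : ℕ) : ℂ)) ^ n *
      (a / powBy L b (1 / ((m + n : ℕ) : ℂ)) ^ m) := by
    rw [arg1, ← Nat.cast_add, powBy_div L hb, phase_pow, mul_one_div]
  have hε := phase_one_div_pow ℓ hq
  have hβ := powBy_one_div_pow hL b hq
  have hβ0 := powBy_ne_zero L hb (1 / ((m + n : ℕ) : ℂ))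
  rw [hz] at hy
  set ε := phase ℓ (1 / ((m + n : ℕ) : ℂ))
  set β := powBy L b (1 / ((m + n : ℕ) : ℂ))
  -- With `x = εβy` one has `x^(m+n) = -b(1 + z y^n)`, and `b z = a ε^n β^n` cancels the middle
  -- term.
  rw [mul_pow, mul_pow, mul_pow, mul_pow, hε, hy, ← hβ, pow_add β]
  field_simp
  ring

theorem trinomial_roots_eq_family_root1 {L : ℂ → ℂ} (hL : IsLogChoice L) {m n : ℕ} (hm : 1 ≤ m) (hn : 1 ≤ n)
    {a b : ℂ} (hb : b ≠ 0)
    (h : a = 0 ∨ bound m n ≤ ‖b‖ ^ m / ‖a‖ ^ (m + n)) :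
    (trinomial m n a b).roots = family (m + n) (root1 L m n a b) := by
  have hq : m + n ≠ 0 := by omega
  have hb' : 0 < ‖b‖ := norm_pos_iff.2 hb
  have hK := bound_pos hm hn
  set c : ℝ := ‖b‖ ^ ((m : ℝ) / ((m : ℝ) + n)) with hc
  have hc0 : 0 < c := Real.rpow_pos_of_pos hb' _
  -- `R` is the radius of convergence in the series argument; in the variable `a` it becomes `R *
  -- c`.
  set R : ℝ := ((bound m n)⁻¹) ^ (1 / ((m + n : ℕ) : ℝ)) with hR
  have hR0 : 0 < R := by positivity
  have hRq : bound m n * R ^ (m + n) = 1 := by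
    have := rpow_div_pow (inv_pos.2 hK).le 1 hq
    rw [Nat.cast_one, pow_one] at this
    rw [hR, this, mul_inv_cancel₀ hK.ne']
  have hρ : 0 < R * c := by positivity
  have hnorm : ∀ (s : ℂ) (ℓ : ℕ), ‖arg1 L m n s b ℓ‖ = ‖s‖ / c := fun s =>
    norm_arg1 hL hm hn s b
  have hconv : ∀ (s : ℂ) (ℓ : ℕ), ‖s‖ ≤ R * c ↔ Converges1 L m n s b ℓ := by
    intro s ℓ
    rw [converges1_iff hm hn, hnorm, ← hRq, mul_le_mul_iff_right₀ hK,
      pow_le_pow_iff_left₀ (by positivity) hR0.le hq, div_le_iff₀ hc0]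
  have hedge : ‖((R * c : ℝ) : ℂ)‖ = R * c := by
    rw [Complex.norm_real, Real.norm_of_nonneg hρ.le]
  have hf : ∀ i : Fin (m + n),
      DiffContOnCl ℂ (fun s => root1 L m n s b i) (Metric.ball 0 (R * c)) := by
    intro i
    have hconv' := (hconv ((R * c : ℝ) : ℂ) i).1 hedge.le
    have hd : Differentiable ℂ fun s => arg1 L m n s b i := by unfold arg1; fun_prop
    have := diffContOnCl_series_comp hconv' hd (ρ := R * c) fun w hw => by
      rw [hnorm, hnorm, hedge]
      exact div_lt_div_of_pos_right (mem_ball_zero_iff.1 hw) hc0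
    exact this.const_smul (phase i (1 / ((m : ℂ) + n)) * powBy L b (1 / ((m : ℂ) + n)))
  have hinj : ∀ᶠ s in 𝓝[≠] (0 : ℂ),
      Function.Injective fun i : Fin (m + n) => root1 L m n s b i := by
    -- At `a = 0` the branches are the distinct `(m+n)`-th roots of `-b`.
    refine eventually_injective (c := fun i => phase i (1 / ((m : ℂ) + n)) *
      powBy L b (1 / ((m : ℂ) + n))) (fun i => ?_) ?_
    · have := (continuousAt_zero_of_diffContOnCl hρ (hf i)).tendsto
      simp only [root1, show arg1 L m n 0 b i = 0 by simp [arg1], series_zero_arg, mul_one] at this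
      exact this.mono_left nhdsWithin_le_nhds
    · intro i j hij
      have := mul_right_cancel₀ (powBy_ne_zero L hb _) hij
      rw [← Nat.cast_add] at this
      exact phase_one_div_injective hq this
  have ha : ‖a‖ ≤ R * c := by
    rw [hconv a 0]
    rcases eq_or_ne a 0 with rfl | ha
    · rw [← hconv, norm_zero]; exact hρ.le
    · exact (converges1_iff_bound_le hL hm hn hb ha 0).2 (h.resolve_left ha)
  have := eq_prod_of_distinct_near_zero hρ (p := fun s => trinomial m n s b)
    (f := fun (i : Fin (m + n)) s => root1 L m n s b i) (fun s => trinomial_monic hm hn s b)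
    (fun s => by rw [trinomial_natDegree hm hn, Fintype.card_fin])
    (fun x => by
      simp only [eval_trinomial]
      exact Differentiable.diffContOnCl (by fun_prop)) hf
    (fun i s hs => isRoot_root1 hL hm hn hb ((hconv s i).1 (mem_ball_zero_iff.1 hs).le)) hinj ha
  rw [this, roots_prod_fin]

/-! ### The second and third series as functions of `β = b ^ (1/n)` -/

/-- The argument of the second series in terms of `β` with `β ^ n = b`. -/
noncomputable def smallArg (L : ℂ → ℂ) (m n : ℕ) (a : ℂ) (ℓ : ℕ) (β : ℂ) : ℂ :=
  phase ℓ (1 / (n : ℂ)) ^ (m + n) * (β ^ m / powBy L a (1 / (n : ℂ)) ^ (m + n))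

/-- The argument of the third series in terms of `β` with `β ^ n = b`. -/
noncomputable def largeArg (L : ℂ → ℂ) (m n : ℕ) (a : ℂ) (ℓ : ℕ) (β : ℂ) : ℂ :=
  (phase ℓ (1 / (m : ℂ)) ^ n)⁻¹ * (β ^ n / powBy L a (1 / (m : ℂ)) ^ (m + n))

/-- The second series solution in terms of `β` with `β ^ n = b`, divided by `β`. -/
noncomputable def smallQuot (L : ℂ → ℂ) (m n : ℕ) (a : ℂ) (ℓ : ℕ) (β : ℂ) : ℂ :=
  phase ℓ (1 / (n : ℂ)) / powBy L a (1 / (n : ℂ)) *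
    series (((m : ℂ) + n) / n) (1 / (n : ℂ)) (smallArg L m n a ℓ β)

/-- The third series solution in terms of `β` with `β ^ n = b`. -/
noncomputable def largeRoot (L : ℂ → ℂ) (m n : ℕ) (a : ℂ) (ℓ : ℕ) (β : ℂ) : ℂ :=
  phase ℓ (1 / (m : ℂ)) * powBy L a (1 / (m : ℂ)) *
    series (-(n : ℂ) / m) (1 / (m : ℂ)) (largeArg L m n a ℓ β)

theorem arg2_eq_smallArg {L : ℂ → ℂ} {m n : ℕ} (hm : 1 ≤ m) (hn : 1 ≤ n) {a : ℂ} (ha : a ≠ 0)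
    (b : ℂ) (ℓ : ℕ) : arg2 L m n a b ℓ = smallArg L m n a ℓ (powBy L b (1 / (n : ℂ))) := by
  have hm' : (m : ℂ) ≠ 0 := Nat.cast_ne_zero.2 (by omega)
  have hn' : (n : ℂ) ≠ 0 := Nat.cast_ne_zero.2 (by omega)
  have hb : powBy L b ((m : ℂ) / n) = powBy L b (1 / (n : ℂ)) ^ m := by
    rcases eq_or_ne b 0 with rfl | hb
    · rw [powBy_zero (div_ne_zero hm' hn'), powBy_zero (one_div_ne_zero hn'), zero_pow (by omega)]
    · exact powBy_div L hb m n
  rw [arg2, smallArg, hb, ← Nat.cast_add, powBy_div L ha, phase_pow, mul_one_div]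

theorem arg3_eq_largeArg {L : ℂ → ℂ} (hL : IsLogChoice L) {m n : ℕ} (hn : 1 ≤ n) {a : ℂ}
    (ha : a ≠ 0) (b : ℂ) (ℓ : ℕ) :
    arg3 L m n a b ℓ = largeArg L m n a ℓ (powBy L b (1 / (n : ℂ))) := by
  rw [arg3, largeArg, powBy_one_div_pow hL b (by omega), ← Nat.cast_add, powBy_div L ha,
    phase_pow, mul_one_div, neg_div, phase_neg]

theorem root2_eq_smallQuot {L : ℂ → ℂ} {m n : ℕ} (hm : 1 ≤ m) (hn : 1 ≤ n) {a : ℂ} (ha : a ≠ 0)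
    (b : ℂ) (ℓ : ℕ) : root2 L m n a b ℓ =
      powBy L b (1 / (n : ℂ)) * smallQuot L m n a ℓ (powBy L b (1 / (n : ℂ))) := by
  rw [root2, smallQuot, arg2_eq_smallArg hm hn ha]; ring

theorem root3_eq_largeRoot {L : ℂ → ℂ} (hL : IsLogChoice L) {m n : ℕ} (hn : 1 ≤ n) {a : ℂ}
    (ha : a ≠ 0) (b : ℂ) (ℓ : ℕ) :
    root3 L m n a b ℓ = largeRoot L m n a ℓ (powBy L b (1 / (n : ℂ))) := by
  rw [root3, largeRoot, arg3_eq_largeArg hL hn ha]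

theorem norm_phase_one_div (ℓ k : ℕ) : ‖phase ℓ (1 / (k : ℂ))‖ = 1 := by
  simpa using norm_phase ℓ (1 / (k : ℝ))

theorem norm_powBy_one_div_pow {L : ℂ → ℂ} (hL : IsLogChoice L) (z : ℂ) {k : ℕ} (hk : k ≠ 0) :
    ‖powBy L z (1 / (k : ℂ))‖ ^ k = ‖z‖ := by
  rw [← norm_pow, powBy_one_div_pow hL z hk]

theorem norm_smallArg (L : ℂ → ℂ) (m n : ℕ) (a : ℂ) (ℓ : ℕ) (β : ℂ) :
    ‖smallArg L m n a ℓ β‖ = ‖β‖ ^ m / ‖powBy L a (1 / (n : ℂ))‖ ^ (m + n) := by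
  rw [smallArg, norm_mul, norm_pow, norm_phase_one_div, one_pow, one_mul, norm_div, norm_pow,
    norm_pow]

theorem norm_largeArg (L : ℂ → ℂ) (m n : ℕ) (a : ℂ) (ℓ : ℕ) (β : ℂ) :
    ‖largeArg L m n a ℓ β‖ = ‖β‖ ^ n / ‖powBy L a (1 / (m : ℂ))‖ ^ (m + n) := by
  rw [largeArg, norm_mul, norm_inv, norm_pow, norm_phase_one_div, one_pow, inv_one, one_mul,
    norm_div, norm_pow, norm_pow]

theorem norm_smallArg_pow {L : ℂ → ℂ} (hL : IsLogChoice L) (m : ℕ) {n : ℕ} (hn : 1 ≤ n) (a : ℂ)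
    (ℓ : ℕ) (β : ℂ) : ‖smallArg L m n a ℓ β‖ ^ n = ‖β‖ ^ (m * n) / ‖a‖ ^ (m + n) := by
  rw [norm_smallArg, div_pow, ← pow_mul, ← pow_mul, mul_comm (m + n), pow_mul _ n,
    norm_powBy_one_div_pow hL a (by omega)]

theorem norm_largeArg_pow {L : ℂ → ℂ} (hL : IsLogChoice L) {m : ℕ} (hm : 1 ≤ m) (n : ℕ) (a : ℂ)
    (ℓ : ℕ) (β : ℂ) : ‖largeArg L m n a ℓ β‖ ^ m = ‖β‖ ^ (m * n) / ‖a‖ ^ (m + n) := by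
  rw [norm_largeArg, div_pow, ← pow_mul, ← pow_mul, mul_comm (m + n), pow_mul _ m,
    norm_powBy_one_div_pow hL a (by omega), mul_comm n m]

/-! ### Convergence criteria for the second and third series -/

theorem seriesConverges_second_iff {m n : ℕ} (hm : 1 ≤ m) (hn : 1 ≤ n) (z : ℂ) :
    SeriesConverges (((m : ℂ) + n) / n) (1 / (n : ℂ)) z ↔ ‖z‖ ^ n ≤ bound m n := by
  have h0 : (0 : ℝ) < 1 / n := by
    have : (0 : ℝ) < n := by exact_mod_cast hn
    positivity
  have := seriesConverges_iff_of_one_lt hm hn h0.ne' (by linarith) z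
  push_cast at this
  exact this

theorem converges2_iff {L : ℂ → ℂ} {m n : ℕ} (hm : 1 ≤ m) (hn : 1 ≤ n) (a b : ℂ) (ℓ : ℕ) :
    Converges2 L m n a b ℓ ↔ ‖arg2 L m n a b ℓ‖ ^ n ≤ bound m n :=
  seriesConverges_second_iff hm hn _

theorem converges3_iff {L : ℂ → ℂ} {m n : ℕ} (hm : 1 ≤ m) (hn : 1 ≤ n) (a b : ℂ) (ℓ : ℕ) :
    Converges3 L m n a b ℓ ↔ ‖arg3 L m n a b ℓ‖ ^ m ≤ bound m n :=
  seriesConverges_iff_of_neg hm hn _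

theorem norm_powBy_one_div_pow_mul {L : ℂ → ℂ} (hL : IsLogChoice L) (b : ℂ) (m : ℕ) {n : ℕ}
    (hn : 1 ≤ n) : ‖powBy L b (1 / (n : ℂ))‖ ^ (m * n) = ‖b‖ ^ m := by
  rw [mul_comm, pow_mul, norm_powBy_one_div_pow hL b (by omega)]

theorem converges2_iff_le_bound {L : ℂ → ℂ} (hL : IsLogChoice L) {m n : ℕ} (hm : 1 ≤ m)
    (hn : 1 ≤ n) {a : ℂ} (ha : a ≠ 0) (b : ℂ) (ℓ : ℕ) :
    Converges2 L m n a b ℓ ↔ ‖b‖ ^ m / ‖a‖ ^ (m + n) ≤ bound m n := by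
  rw [converges2_iff hm hn, arg2_eq_smallArg hm hn ha, norm_smallArg_pow hL m hn,
    norm_powBy_one_div_pow_mul hL b m hn]

theorem converges3_iff_le_bound {L : ℂ → ℂ} (hL : IsLogChoice L) {m n : ℕ} (hm : 1 ≤ m)
    (hn : 1 ≤ n) {a : ℂ} (ha : a ≠ 0) (b : ℂ) (ℓ : ℕ) :
    Converges3 L m n a b ℓ ↔ ‖b‖ ^ m / ‖a‖ ^ (m + n) ≤ bound m n := by
  rw [converges3_iff hm hn, arg3_eq_largeArg hL hn ha, norm_largeArg_pow hL hm,
    norm_powBy_one_div_pow_mul hL b m hn]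

theorem converges2_iff_le {L : ℂ → ℂ} (hL : IsLogChoice L) {m n : ℕ} (hm : 1 ≤ m)
    (hn : 1 ≤ n) {a : ℂ} (ha : a ≠ 0) (b : ℂ) (ℓ : ℕ) :
    Converges2 L m n a b ℓ ↔ ‖b‖ ^ ((m : ℝ) / n) / ‖a‖ ^ (((m : ℝ) + n) / n) ≤
      (n : ℝ) / (((m : ℝ) + n) ^ (((m : ℝ) + n) / n) * (m : ℝ) ^ (-(m : ℝ) / n)) := by
  have hn0 : n ≠ 0 := by omega
  rw [converges2_iff_le_bound hL hm hn ha, ← pow_le_pow_iff_left₀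
    (a := ‖b‖ ^ ((m : ℝ) / n) / ‖a‖ ^ (((m : ℝ) + n) / n)) (by positivity) (by positivity) hn0]
  rw [div_pow, div_pow, mul_pow, rpow_div_pow (norm_nonneg _) _ hn0,
    rpow_add_div_pow (norm_nonneg _) _ _ hn0, rpow_add_div_pow (by positivity) _ _ hn0,
    rpow_neg_div_pow (by positivity) _ hn0]
  have : bound m n = (n : ℝ) ^ n / (((m : ℝ) + n) ^ (m + n) * ((m : ℝ) ^ m)⁻¹) := by
    unfold bound; field_simp
  rw [this]

theorem converges3_iff_le {L : ℂ → ℂ} (hL : IsLogChoice L) {m n : ℕ} (hm : 1 ≤ m)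
    (hn : 1 ≤ n) {a : ℂ} (ha : a ≠ 0) (b : ℂ) (ℓ : ℕ) :
    Converges3 L m n a b ℓ ↔ ‖b‖ / ‖a‖ ^ (((m : ℝ) + n) / m) ≤
      (m : ℝ) / ((n : ℝ) ^ (-(n : ℝ) / m) * ((m : ℝ) + n) ^ (((m : ℝ) + n) / m)) := by
  have hm0 : m ≠ 0 := by omega
  rw [converges3_iff_le_bound hL hm hn ha, ← pow_le_pow_iff_left₀
    (a := ‖b‖ / ‖a‖ ^ (((m : ℝ) + n) / m)) (by positivity) (by positivity) hm0]
  rw [div_pow, div_pow, mul_pow, rpow_add_div_pow (norm_nonneg _) _ _ hm0,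
    rpow_add_div_pow (by positivity) _ _ hm0, rpow_neg_div_pow (by positivity) _ hm0]
  have : bound m n = (m : ℝ) ^ m / (((n : ℝ) ^ n)⁻¹ * ((m : ℝ) + n) ^ (m + n)) := by
    unfold bound; field_simp
  rw [this]

/-! ### The branches in the variable `β` and their completeness -/

theorem isRoot_smallQuot {L : ℂ → ℂ} (hL : IsLogChoice L) {m n : ℕ} (hn : 1 ≤ n)
    {a : ℂ} (ha : a ≠ 0) {ℓ : ℕ} {β : ℂ}
    (h : SeriesConverges (((m : ℂ) + n) / n) (1 / (n : ℂ)) (smallArg L m n a ℓ β)) :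
    (trinomial m n a (β ^ n)).IsRoot (β * smallQuot L m n a ℓ β) := by
  have hn0 : n ≠ 0 := by omega
  rw [IsRoot, eval_trinomial, smallQuot]
  rw [← Nat.cast_add] at h ⊢
  have hy := series_pow_eq hn0 h
  set y := series ((m + n : ℕ) / (n : ℂ)) (1 / (n : ℂ)) (smallArg L m n a ℓ β)
  have hε := phase_one_div_pow ℓ hn0
  have hα := powBy_one_div_pow hL a hn0
  have hα0 := powBy_ne_zero L ha (1 / (n : ℂ))
  rw [smallArg] at hy
  set ε := phase ℓ (1 / (n : ℂ))
  set α := powBy L a (1 / (n : ℂ))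
  have e : (β * (ε / α * y)) ^ n = -(β ^ n / α ^ n) * y ^ n := by
    rw [mul_pow, mul_pow, div_pow, hε]; ring
  rw [e, hy, ← hα, mul_pow, mul_pow, div_pow]
  field_simp
  ring

theorem isRoot_largeRoot {L : ℂ → ℂ} (hL : IsLogChoice L) {m n : ℕ} (hm : 1 ≤ m)
    {a : ℂ} (ha : a ≠ 0) {ℓ : ℕ} {β : ℂ}
    (h : SeriesConverges (-(n : ℂ) / m) (1 / (m : ℂ)) (largeArg L m n a ℓ β)) :
    (trinomial m n a (β ^ n)).IsRoot (largeRoot L m n a ℓ β) := by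
  have hm0 : m ≠ 0 := by omega
  rw [IsRoot, eval_trinomial, largeRoot]
  have hy := series_neg_pow_eq hm0 h
  set y := series (-(n : ℂ) / m) (1 / (m : ℂ)) (largeArg L m n a ℓ β)
  have hε := phase_one_div_pow ℓ hm0
  have hε0 := phase_ne_zero ℓ (1 / (m : ℂ))
  have hα := powBy_one_div_pow hL a hm0
  have hα0 := powBy_ne_zero L ha (1 / (m : ℂ))
  rw [largeArg] at hy
  set ε := phase ℓ (1 / (m : ℂ))
  set α := powBy L a (1 / (m : ℂ))
  rw [mul_pow, mul_pow, mul_pow, mul_pow, hy, pow_add ε, hε, ← hα, pow_add α]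
  field_simp
  ring

theorem smallQuot_zero {L : ℂ → ℂ} {m : ℕ} (hm : 1 ≤ m) (n : ℕ) (a : ℂ) (ℓ : ℕ) :
    smallQuot L m n a ℓ 0 = phase ℓ (1 / (n : ℂ)) / powBy L a (1 / (n : ℂ)) := by
  rw [smallQuot, show smallArg L m n a ℓ 0 = 0 by
    rw [smallArg, zero_pow (by omega), zero_div, mul_zero], series_zero_arg, mul_one]

theorem largeRoot_zero {L : ℂ → ℂ} (m : ℕ) {n : ℕ} (hn : 1 ≤ n) (a : ℂ) (ℓ : ℕ) :
    largeRoot L m n a ℓ 0 = phase ℓ (1 / (m : ℂ)) * powBy L a (1 / (m : ℂ)) := by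
  rw [largeRoot, show largeArg L m n a ℓ 0 = 0 by
    rw [largeArg, zero_pow (by omega), zero_div, mul_zero], series_zero_arg, mul_one]

/-- The radius of convergence in the variable `β`. -/
noncomputable def betaRadius (m n : ℕ) (a : ℂ) : ℝ :=
  (bound m n * ‖a‖ ^ (m + n)) ^ (1 / ((m * n : ℕ) : ℝ))

theorem betaRadius_pos {m n : ℕ} (hm : 1 ≤ m) (hn : 1 ≤ n) {a : ℂ} (ha : a ≠ 0) :
    0 < betaRadius m n a :=
  Real.rpow_pos_of_pos (mul_pos (bound_pos hm hn) (pow_pos (norm_pos_iff.2 ha) _)) _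

theorem le_betaRadius_iff {m n : ℕ} (hm : 1 ≤ m) (hn : 1 ≤ n) {a : ℂ} (ha : a ≠ 0) (β : ℂ) :
    ‖β‖ ≤ betaRadius m n a ↔ ‖β‖ ^ (m * n) / ‖a‖ ^ (m + n) ≤ bound m n := by
  have ha' : 0 < ‖a‖ := norm_pos_iff.2 ha
  have hmn : m * n ≠ 0 := mul_ne_zero (by omega) (by omega)
  have h := rpow_div_pow (mul_pos (bound_pos hm hn) (pow_pos ha' (m + n))).le 1 hmn
  rw [Nat.cast_one, pow_one] at h
  rw [div_le_iff₀ (pow_pos ha' _), ← h,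
    pow_le_pow_iff_left₀ (norm_nonneg _) (Real.rpow_nonneg (by
      have := bound_pos hm hn
      positivity) _) hmn]
  rfl

theorem norm_betaRadius {m n : ℕ} (hm : 1 ≤ m) (hn : 1 ≤ n) {a : ℂ} (ha : a ≠ 0) :
    ‖((betaRadius m n a : ℝ) : ℂ)‖ = betaRadius m n a := by
  rw [Complex.norm_real, Real.norm_of_nonneg (betaRadius_pos hm hn ha).le]

theorem diffContOnCl_smallQuot {L : ℂ → ℂ} (hL : IsLogChoice L) {m n : ℕ} (hm : 1 ≤ m)
    (hn : 1 ≤ n) {a : ℂ} (ha : a ≠ 0) (ℓ : ℕ) :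
    DiffContOnCl ℂ (smallQuot L m n a ℓ) (Metric.ball 0 (betaRadius m n a)) := by
  have hα0 := norm_pos_iff.2 (powBy_ne_zero L ha (1 / (n : ℂ)))
  have hconv : SeriesConverges (((m : ℂ) + n) / n) (1 / (n : ℂ))
      (smallArg L m n a ℓ (betaRadius m n a)) := by
    rw [seriesConverges_second_iff hm hn, norm_smallArg_pow hL m hn, ← le_betaRadius_iff hm hn ha,
      norm_betaRadius hm hn ha]
  have hd : Differentiable ℂ (smallArg L m n a ℓ) := by unfold smallArg; fun_prop
  refine (diffContOnCl_series_comp hconv hd fun w hw => ?_).const_smul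
    (phase ℓ (1 / (n : ℂ)) / powBy L a (1 / (n : ℂ)))
  rw [norm_smallArg, norm_smallArg, norm_betaRadius hm hn ha]
  exact div_lt_div_of_pos_right (pow_lt_pow_left₀ (mem_ball_zero_iff.1 hw) (norm_nonneg _)
    (by omega)) (pow_pos hα0 _)

theorem diffContOnCl_largeRoot {L : ℂ → ℂ} (hL : IsLogChoice L) {m n : ℕ} (hm : 1 ≤ m)
    (hn : 1 ≤ n) {a : ℂ} (ha : a ≠ 0) (ℓ : ℕ) :
    DiffContOnCl ℂ (largeRoot L m n a ℓ) (Metric.ball 0 (betaRadius m n a)) := by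
  have hα0 := norm_pos_iff.2 (powBy_ne_zero L ha (1 / (m : ℂ)))
  have hconv : SeriesConverges (-(n : ℂ) / m) (1 / (m : ℂ))
      (largeArg L m n a ℓ (betaRadius m n a)) := by
    rw [seriesConverges_iff_of_neg hm hn, norm_largeArg_pow hL hm, ← le_betaRadius_iff hm hn ha,
      norm_betaRadius hm hn ha]
  have hd : Differentiable ℂ (largeArg L m n a ℓ) := by unfold largeArg; fun_prop
  refine (diffContOnCl_series_comp hconv hd fun w hw => ?_).const_smul
    (phase ℓ (1 / (m : ℂ)) * powBy L a (1 / (m : ℂ)))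
  rw [norm_largeArg, norm_largeArg, norm_betaRadius hm hn ha]
  exact div_lt_div_of_pos_right (pow_lt_pow_left₀ (mem_ball_zero_iff.1 hw) (norm_nonneg _)
    (by omega)) (pow_pos hα0 _)

theorem tendsto_smallQuot {L : ℂ → ℂ} (hL : IsLogChoice L) {m n : ℕ} (hm : 1 ≤ m)
    (hn : 1 ≤ n) {a : ℂ} (ha : a ≠ 0) (ℓ : ℕ) : Tendsto (smallQuot L m n a ℓ) (𝓝 0)
      (𝓝 (phase ℓ (1 / (n : ℂ)) / powBy L a (1 / (n : ℂ)))) := by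
  rw [← smallQuot_zero hm n a ℓ]
  exact (continuousAt_zero_of_diffContOnCl (betaRadius_pos hm hn ha)
    (diffContOnCl_smallQuot hL hm hn ha ℓ)).tendsto

theorem tendsto_largeRoot {L : ℂ → ℂ} (hL : IsLogChoice L) {m n : ℕ} (hm : 1 ≤ m)
    (hn : 1 ≤ n) {a : ℂ} (ha : a ≠ 0) (ℓ : ℕ) : Tendsto (largeRoot L m n a ℓ) (𝓝 0)
      (𝓝 (phase ℓ (1 / (m : ℂ)) * powBy L a (1 / (m : ℂ)))) := by
  rw [← largeRoot_zero m hn a ℓ]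
  exact (continuousAt_zero_of_diffContOnCl (betaRadius_pos hm hn ha)
    (diffContOnCl_largeRoot hL hm hn ha ℓ)).tendsto

theorem tendsto_mul_smallQuot {L : ℂ → ℂ} (hL : IsLogChoice L) {m n : ℕ} (hm : 1 ≤ m)
    (hn : 1 ≤ n) {a : ℂ} (ha : a ≠ 0) (ℓ : ℕ) :
    Tendsto (fun β => β * smallQuot L m n a ℓ β) (𝓝 0) (𝓝 0) := by
  simpa using tendsto_id.mul (tendsto_smallQuot hL hm hn ha ℓ)

/-- The small branches all tend to `0`, so their limits do not separate them. The quotients by `β`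
have the distinct limits `ε_ℓ / a^(1/n)`, which is enough for `β ≠ 0`. The large branches have
distinct nonzero limits, hence also avoid the small ones. -/
theorem eventually_injective_branches {L : ℂ → ℂ} (hL : IsLogChoice L) {m n : ℕ} (hm : 1 ≤ m)
    (hn : 1 ≤ n) {a : ℂ} (ha : a ≠ 0) : ∀ᶠ β in 𝓝[≠] (0 : ℂ), Function.Injective
      fun i : Fin n ⊕ Fin m => Sum.elim (fun (i : Fin n) β => β * smallQuot L m n a i β)
        (fun (j : Fin m) β => largeRoot L m n a j β) i β := by
  have hle : 𝓝[≠] (0 : ℂ) ≤ 𝓝 0 := nhdsWithin_le_nhds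
  have h1 : ∀ᶠ β in 𝓝[≠] (0 : ℂ), Function.Injective fun i : Fin n => smallQuot L m n a i β :=
    eventually_injective (fun i => (tendsto_smallQuot hL hm hn ha i).mono_left hle) fun i j hij =>
      phase_one_div_injective (by omega) ((div_left_inj' (powBy_ne_zero L ha _)).1 hij)
  have h2 : ∀ᶠ β in 𝓝[≠] (0 : ℂ), Function.Injective fun i : Fin m => largeRoot L m n a i β :=
    eventually_injective (fun i => (tendsto_largeRoot hL hm hn ha i).mono_left hle) fun i j hij =>
      phase_one_div_injective (by omega) (mul_right_cancel₀ (powBy_ne_zero L ha _) hij)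
  have h3 : ∀ᶠ β in 𝓝[≠] (0 : ℂ), ∀ (i : Fin n) (j : Fin m),
      β * smallQuot L m n a i β ≠ largeRoot L m n a j β := by
    simp only [eventually_all]
    intro i j
    have h := (tendsto_largeRoot hL hm hn ha j).sub (tendsto_mul_smallQuot hL hm hn ha i)
    rw [sub_zero] at h
    refine (h.mono_left hle).eventually_ne
      (mul_ne_zero (phase_ne_zero _ _) (powBy_ne_zero L ha _)) |>.mono fun β hβ he => ?_
    exact hβ (by rw [he, sub_self])
  filter_upwards [h1, h2, h3, self_mem_nhdsWithin] with β hβ1 hβ2 hβ3 hβ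
  have h4 : Function.Injective fun i : Fin n => β * smallQuot L m n a i β := fun i j hij =>
    hβ1 (mul_left_cancel₀ hβ hij)
  rintro (i | i) (j | j) hij
  · exact congrArg _ (h4 hij)
  · exact absurd hij (hβ3 i j)
  · exact absurd hij.symm (hβ3 j i)
  · exact congrArg _ (hβ2 hij)

theorem trinomial_roots_eq_family_root2_root3 {L : ℂ → ℂ} (hL : IsLogChoice L) {m n : ℕ}
    (hm : 1 ≤ m) (hn : 1 ≤ n) {a b : ℂ} (ha : a ≠ 0)
    (h : ‖b‖ ^ m / ‖a‖ ^ (m + n) ≤ bound m n) : (trinomial m n a b).roots =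
      family n (root2 L m n a b) + family m (root3 L m n a b) := by
  set β := powBy L b (1 / (n : ℂ)) with hβ
  have hβρ : ‖β‖ ≤ betaRadius m n a := by
    rwa [le_betaRadius_iff hm hn ha, hβ, norm_powBy_one_div_pow_mul hL b m hn]
  have hball : ∀ s ∈ Metric.ball (0 : ℂ) (betaRadius m n a),
      ‖s‖ ^ (m * n) / ‖a‖ ^ (m + n) ≤ bound m n := fun s hs =>
    (le_betaRadius_iff hm hn ha s).1 (mem_ball_zero_iff.1 hs).le
  have key := eq_prod_of_distinct_near_zero (betaRadius_pos hm hn ha)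
    (p := fun s => trinomial m n a (s ^ n))
    (f := Sum.elim (fun (i : Fin n) β => β * smallQuot L m n a i β)
      (fun (j : Fin m) β => largeRoot L m n a j β))
    (fun s => trinomial_monic hm hn a _)
    (fun s => by rw [trinomial_natDegree hm hn, Fintype.card_sum, Fintype.card_fin,
      Fintype.card_fin, add_comm])
    (fun x => by
      simp only [eval_trinomial]
      exact Differentiable.diffContOnCl (by fun_prop))
    (by
      rintro (i | j)
      · exact differentiable_id.diffContOnCl.smul (diffContOnCl_smallQuot hL hm hn ha i)
      · exact diffContOnCl_largeRoot hL hm hn ha j)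
    (by
      rintro (i | j) s hs
      · refine isRoot_smallQuot hL hn ha ?_
        rw [seriesConverges_second_iff hm hn, norm_smallArg_pow hL m hn]
        exact hball s hs
      · refine isRoot_largeRoot hL hm ha ?_
        rw [seriesConverges_iff_of_neg hm hn, norm_largeArg_pow hL hm]
        exact hball s hs)
    (eventually_injective_branches hL hm hn ha) hβρ
  simp only [Fintype.prod_sum_type, Sum.elim_inl, Sum.elim_inr] at key
  rw [hβ, powBy_one_div_pow hL b (by omega), ← hβ] at key
  rw [key, roots_prod_sum n m (fun i => β * smallQuot L m n a i β) (largeRoot L m n a · β)]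
  congr 2
  · funext ℓ; exact (root2_eq_smallQuot hm hn ha b ℓ).symm
  · funext ℓ; exact (root3_eq_largeRoot hL hn ha b ℓ).symm

/-! ### Limits as `b → 0` -/

theorem tendsto_powBy_one_div {L : ℂ → ℂ} (hL : IsLogChoice L) {n : ℕ} (hn : 1 ≤ n) :
    Tendsto (fun b => powBy L b (1 / (n : ℂ))) (𝓝 0) (𝓝 0) := by
  -- `L` need not be continuous, but the norm `‖b‖^(1/n)` does not depend on it.
  rw [tendsto_zero_iff_norm_tendsto_zero]
  have hn0 : (0 : ℝ) < 1 / n := by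
    have : (0 : ℝ) < n := by exact_mod_cast hn
    positivity
  have h : ∀ b, ‖powBy L b (1 / (n : ℂ))‖ = ‖b‖ ^ (1 / (n : ℝ)) := fun b => by
    simpa using norm_powBy hL b hn0.ne'
  simp only [h]
  have h1 := (continuous_norm (E := ℂ)).tendsto 0 |>.rpow_const (p := 1 / (n : ℝ)) (Or.inr hn0.le)
  rwa [norm_zero, Real.zero_rpow hn0.ne'] at h1

theorem tendsto_root2 {L : ℂ → ℂ} (hL : IsLogChoice L) {m n : ℕ} (hm : 1 ≤ m)
    (hn : 1 ≤ n) {a : ℂ} (ha : a ≠ 0) (ℓ : ℕ) :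
    Tendsto (fun b => root2 L m n a b ℓ) (𝓝 0) (𝓝 0) := by
  simp only [root2_eq_smallQuot hm hn ha]
  exact (tendsto_mul_smallQuot hL hm hn ha ℓ).comp (tendsto_powBy_one_div hL hn)

theorem tendsto_root3 {L : ℂ → ℂ} (hL : IsLogChoice L) {m n : ℕ} (hm : 1 ≤ m)
    (hn : 1 ≤ n) {a : ℂ} (ha : a ≠ 0) (ℓ : ℕ) : Tendsto (fun b => root3 L m n a b ℓ) (𝓝 0)
      (𝓝 (phase ℓ (1 / (m : ℂ)) * powBy L a (1 / (m : ℂ)))) := by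
  simp only [root3_eq_largeRoot hL hn ha]
  exact (tendsto_largeRoot hL hm hn ha ℓ).comp (tendsto_powBy_one_div hL hn)

theorem roots_X_pow_add_C {L : ℂ → ℂ} (hL : IsLogChoice L) {m : ℕ} (hm : 1 ≤ m) {a : ℂ}
    (ha : a ≠ 0) : (X ^ m + C a : ℂ[X]).roots =
      family m (fun ℓ => phase ℓ (1 / (m : ℂ)) * powBy L a (1 / (m : ℂ))) := by
  have hm0 : m ≠ 0 := by omega
  -- The general lemma with constant families: `m` distinct roots of a monic polynomial of degree
  -- `m`.
  have key := eq_prod_of_distinct_near_zero one_pos (p := fun _ => X ^ m + C a)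
    (f := fun (ℓ : Fin m) _ => phase ℓ (1 / (m : ℂ)) * powBy L a (1 / (m : ℂ)))
    (fun _ => monic_X_pow_add_C a hm0)
    (fun _ => by rw [natDegree_X_pow_add_C, Fintype.card_fin])
    (fun _ => diffContOnCl_const) (fun _ => diffContOnCl_const)
    (fun ℓ _ _ => by
      simp [mul_pow, phase_one_div_pow ℓ hm0, powBy_one_div_pow hL a hm0, -one_div])
    (Eventually.of_forall fun _ i j hij =>
      phase_one_div_injective hm0 (mul_right_cancel₀ (powBy_ne_zero L ha _) hij))
    (s := 0) (by simp)
  rw [key, roots_prod_fin m fun ℓ => phase ℓ (1 / (m : ℂ)) * powBy L a (1 / (m : ℂ))]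

end FussCatalan

theorem mainTheorem7 (L : ℂ → ℂ) (hL : FussCatalan.IsLogChoice L)
    (m n : ℕ) (hm : 1 ≤ m) (hn : 1 ≤ n) :
    -- first series: domain of convergence, and all `m + n` roots there
    (∀ a b : ℂ, b ≠ 0 →
      (∀ ℓ < m + n,
        (FussCatalan.Converges1 L m n a b ℓ ↔
          ‖a‖ / ‖b‖ ^ ((m : ℝ) / ((m : ℝ) + n)) ≤
            ((m : ℝ) + n) /
              ((n : ℝ) ^ ((n : ℝ) / ((m : ℝ) + n)) * (m : ℝ) ^ ((m : ℝ) / ((m : ℝ) + n)))) ∧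
        (a ≠ 0 → (FussCatalan.Converges1 L m n a b ℓ ↔
          FussCatalan.bound m n ≤ ‖b‖ ^ m / ‖a‖ ^ (m + n)))) ∧
      ((a = 0 ∨ FussCatalan.bound m n ≤ ‖b‖ ^ m / ‖a‖ ^ (m + n)) →
        (FussCatalan.trinomial m n a b).roots =
          FussCatalan.family (m + n) (FussCatalan.root1 L m n a b))) ∧
    -- second and third series: domains of convergence, and all `n + m` roots there
    (∀ a b : ℂ, a ≠ 0 →
      (∀ ℓ < n,
        (FussCatalan.Converges2 L m n a b ℓ ↔
          ‖b‖ ^ ((m : ℝ) / n) / ‖a‖ ^ (((m : ℝ) + n) / n) ≤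
            (n : ℝ) / (((m : ℝ) + n) ^ (((m : ℝ) + n) / n) * (m : ℝ) ^ (-(m : ℝ) / n))) ∧
        (FussCatalan.Converges2 L m n a b ℓ ↔
          ‖b‖ ^ m / ‖a‖ ^ (m + n) ≤ FussCatalan.bound m n)) ∧
      (∀ ℓ < m,
        (FussCatalan.Converges3 L m n a b ℓ ↔
          ‖b‖ / ‖a‖ ^ (((m : ℝ) + n) / m) ≤
            (m : ℝ) / ((n : ℝ) ^ (-(n : ℝ) / m) * ((m : ℝ) + n) ^ (((m : ℝ) + n) / m))) ∧
        (FussCatalan.Converges3 L m n a b ℓ ↔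
          ‖b‖ ^ m / ‖a‖ ^ (m + n) ≤ FussCatalan.bound m n)) ∧
      (‖b‖ ^ m / ‖a‖ ^ (m + n) ≤ FussCatalan.bound m n →
        (FussCatalan.trinomial m n a b).roots =
          FussCatalan.family n (FussCatalan.root2 L m n a b) +
            FussCatalan.family m (FussCatalan.root3 L m n a b))) ∧
    -- as `b → 0` the second series gives the branches tending to `0`, and the third one
    -- those tending to the `m`-th roots of `-a`
    (∀ a : ℂ, a ≠ 0 →
      (∀ ℓ < n, Tendsto (fun b : ℂ => FussCatalan.root2 L m n a b ℓ) (𝓝[≠] 0) (𝓝 0)) ∧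
      (∀ ℓ < m, Tendsto (fun b : ℂ => FussCatalan.root3 L m n a b ℓ) (𝓝[≠] 0)
        (𝓝 (FussCatalan.phase ℓ (1 / (m : ℂ)) * FussCatalan.powBy L a (1 / (m : ℂ))))) ∧
      (X ^ m + C a : ℂ[X]).roots =
        FussCatalan.family m
          (fun ℓ => FussCatalan.phase ℓ (1 / (m : ℂ)) * FussCatalan.powBy L a (1 / (m : ℂ)))) ∧
    -- together the three series give all roots for all coefficients
    (∀ a b : ℂ, (a, b) ≠ (0, 0) →
      (b ≠ 0 ∧ (∀ ℓ < m + n, FussCatalan.Converges1 L m n a b ℓ) ∧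
        (FussCatalan.trinomial m n a b).roots =
          FussCatalan.family (m + n) (FussCatalan.root1 L m n a b)) ∨
      (a ≠ 0 ∧ (∀ ℓ < n, FussCatalan.Converges2 L m n a b ℓ) ∧
        (∀ ℓ < m, FussCatalan.Converges3 L m n a b ℓ) ∧
        (FussCatalan.trinomial m n a b).roots =
          FussCatalan.family n (FussCatalan.root2 L m n a b) +
            FussCatalan.family m (FussCatalan.root3 L m n a b))) := by
  refine ⟨fun a b hb => ⟨fun ℓ _ => ⟨FussCatalan.converges1_iff_le hL hm hn a b ℓ,
      fun ha => FussCatalan.converges1_iff_bound_le hL hm hn hb ha ℓ⟩,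
      FussCatalan.trinomial_roots_eq_family_root1 hL hm hn hb⟩,
    fun a b ha => ⟨fun ℓ _ => ⟨FussCatalan.converges2_iff_le hL hm hn ha b ℓ,
      FussCatalan.converges2_iff_le_bound hL hm hn ha b ℓ⟩,
      fun ℓ _ => ⟨FussCatalan.converges3_iff_le hL hm hn ha b ℓ,
      FussCatalan.converges3_iff_le_bound hL hm hn ha b ℓ⟩,
      FussCatalan.trinomial_roots_eq_family_root2_root3 hL hm hn ha⟩,
    fun a ha => ⟨fun ℓ _ => (FussCatalan.tendsto_root2 hL hm hn ha ℓ).mono_left nhdsWithin_le_nhds,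
      fun ℓ _ => (FussCatalan.tendsto_root3 hL hm hn ha ℓ).mono_left nhdsWithin_le_nhds,
      FussCatalan.roots_X_pow_add_C hL hm ha⟩, fun a b hab => ?_⟩
  have large (ha : a ≠ 0) (h : ‖b‖ ^ m / ‖a‖ ^ (m + n) ≤ FussCatalan.bound m n) :
      (∀ ℓ < n, FussCatalan.Converges2 L m n a b ℓ) ∧
        (∀ ℓ < m, FussCatalan.Converges3 L m n a b ℓ) ∧
        (FussCatalan.trinomial m n a b).roots =
          FussCatalan.family n (FussCatalan.root2 L m n a b) +
            FussCatalan.family m (FussCatalan.root3 L m n a b) :=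
    ⟨fun ℓ _ => (FussCatalan.converges2_iff_le_bound hL hm hn ha b ℓ).2 h,
      fun ℓ _ => (FussCatalan.converges3_iff_le_bound hL hm hn ha b ℓ).2 h,
      FussCatalan.trinomial_roots_eq_family_root2_root3 hL hm hn ha h⟩
  rcases eq_or_ne b 0 with rfl | hb
  · have ha : a ≠ 0 := fun ha => hab (by rw [ha])
    refine Or.inr ⟨ha, large ha ?_⟩
    rw [norm_zero, zero_pow (by omega), zero_div]
    exact (FussCatalan.bound_pos hm hn).le
  -- The case `a = 0` is separate because `‖b‖^m / 0` is `0` in Lean, which would fall on the wrong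
  -- side of the bound.
  rcases eq_or_ne a 0 with rfl | ha
  · refine Or.inl ⟨hb, fun ℓ _ => ?_,
      FussCatalan.trinomial_roots_eq_family_root1 hL hm hn hb (Or.inl rfl)⟩
    rw [FussCatalan.converges1_iff_le hL hm hn, norm_zero, zero_div]
    positivity
  rcases le_total (FussCatalan.bound m n) (‖b‖ ^ m / ‖a‖ ^ (m + n)) with h | h
  · exact Or.inl ⟨hb, fun ℓ _ => (FussCatalan.converges1_iff_bound_le hL hm hn hb ha ℓ).2 h,
      FussCatalan.trinomial_roots_eq_family_root1 hL hm hn hb (Or.inr h)⟩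
  · exact Or.inr ⟨ha, large ha h⟩
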